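/- **Notation.** $(x)_n=x(x+1)\cdots(x+n-1)$; for $\mathbf a=(a_1,\dots,a_p)$ write $\Gamma(\mathbf a)=\prod_i\Gamma(a_i)$. For $\Re(\xi)>0$ and $b_j\notin\{0,-1,-2,\dots\}$ put $$ {}_pM_q^{\xi,\eta}(w)=\sum_{n\ge0}\frac{(a_1)_n\cdots(a_p)_n}{(b_1)_n\cdots(b_q)_n}\frac{w^n}{\Gamma(\xi n+\eta)},\qquad {}_pK_q^{\xi,\eta;\nu}(w)=\sum_{n\ge0}\frac{(a_1)_n\cdots(a_p)_n}{(b_1)_n\cdots(b_q)_n}\frac{(\nu)_n}{\Gamma(\xi n+\eta)}\frac{w^n}{n!}.$$ The Fox–Wright function is $$ {}_p\psi_q\left(\begin{matrix}(a_i,\alpha_i)_1^p\\(b_j,\beta_j)_1^q\end{matrix};w\right)=\sum_{n\ge0}\frac{\prod_{i}\Gamma(a_i+\alpha_in)}{\prod_{j}\Gamma(b_j+\beta_jn)}\frac{w^n}{n!}.$$ Appell's function is $$F_3(\alpha,\alpha',\beta,\beta';\gamma;x,y)=\sum_{m,n\ge0}\frac{(\alpha)_m(\alpha')_n(\beta)_m(\beta')_n}{(\gamma)_{m+n}}\frac{x^m}{m!}\frac{y^n}{n!}\qquad(|x|,|y|<1),$$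 continued analytically in $y$ along the segment from $0$ to $y$ when $|x|<1$ and $y\le-1$. For $\Re(\gamma)>0$ and $z>0$, the left-sided Saigo–Maeda fractional integral is $$\left(\mathcal I_{0+}^{\alpha,\alpha',\beta,\beta',\gamma}f\right)(z)=\frac{z^{-\alpha}}{\Gamma(\gamma)}\int_0^z(z-t)^{\gamma-1}t^{-\alpha'}F_3\left(\alpha,\alpha',\beta,\beta';\gamma;1-\tfrac tz,1-\tfrac zt\right)f(t)\,dt .$$ **Theorem.** Let $\alpha,\alpha',\beta,\beta',\gamma,\eta,\nu,\xi,\sigma\in\mathbb C$ with $\Re(\nu)>0$, $\Re(\xi)>0$, $\Re(\gamma)>0$, let $\mu>0$, $c\in\mathbb R$, $p,q\ge 0$, $a_i\in\mathbb C$ $(1\le i\le p)$ and $b_j\in\mathbb C\setminus\{0,-1,-2,\dots\}$ $(1\le j\le q)$. Then for $z>0$ $$\mathcal I_{0+}^{\alpha,\alpha',\beta,\beta',\gamma}\left(t^{\sigma-1}{}_pM_q^{\xi,\eta}(ct^\mu)\right)(z)=\frac{\Gamma(\mathbf b)}{\Gamma(\mathbf a)}\,z^{\sigma-\alpha-\alpha'+\gamma-1}\;{}_{p+4}\psi_{q+4}\left(\begin{matrix}(a_i,1)_1^p,(\sigma,\mu),(\sigma+\gamma-\alpha-\alpha'-\beta,\mu),(\sigma+\beta'-\alpha',\mu),(1,1)\\(b_j,1)_1^q,(\sigma+\gamma-\alpha-\alpha',\mu),(\sigma+\gamma-\alpha'-\beta,\mu),(\sigma+\beta',\mu),(\eta,\xi)\end{matrix};cz^\mu\right)$$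 and $$\mathcal I_{0+}^{\alpha,\alpha',\beta,\beta',\gamma}\left(t^{\sigma-1}{}_pK_q^{\xi,\eta;\nu}(ct^\mu)\right)(z)=\frac{\Gamma(\mathbf b)}{\Gamma(\mathbf a)}\,\frac{z^{\sigma-\alpha-\alpha'+\gamma-1}}{\Gamma(\nu)}\;{}_{p+4}\psi_{q+4}\left(\begin{matrix}(a_i,1)_1^p,(\sigma,\mu),(\sigma+\gamma-\alpha-\alpha'-\beta,\mu),(\sigma+\beta'-\alpha',\mu),(\nu,1)\\(b_j,1)_1^q,(\sigma+\gamma-\alpha-\alpha',\mu),(\sigma+\gamma-\alpha'-\beta,\mu),(\sigma+\beta',\mu),(\eta,\xi)\end{matrix};cz^\mu\right),$$ each provided that both members of the equation exist, that is: the $M$-series (respectively the $K$-series) converges absolutely at $ct^\mu$ for $0<t<z$, the integral on the left converges absolutely, no Gamma function in a numerator of the Fox–Wright series is evaluated at a pole, and the Fox–Wright series on the right converges absolutely (where a Gamma function in a denominator has a pole, its reciprocal is $0$). -/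

import Mathlib

open Complex Set Filter Topology

noncomputable section

/-- The Pochhammer symbol `(x)_n = x (x + 1) ⋯ (x + n - 1)`. -/
def poch (x : ℂ) (n : ℕ) : ℂ := (ascPochhammer ℂ n).eval x

/-! ### Analytic continuation along the straight segment from the origin -/

/-- `w` is the value at `y` of the analytic continuation of the germ of `f` at `0` along the
segment `[0, y]`: some function, holomorphic on an open convex set containing `0` and `y`,
coincides with `f` near `0` and takes the value `w` at `y`. -/
def IsContinuationValue (f : ℂ → ℂ) (y w : ℂ) : Prop :=
  ∃ (V : Set ℂ) (g : ℂ → ℂ), IsOpen V ∧ Convex ℝ V ∧ (0 : ℂ) ∈ V ∧ y ∈ V ∧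
    DifferentiableOn ℂ g V ∧ g =ᶠ[𝓝 0] f ∧ g y = w

theorem IsContinuationValue.unique {f : ℂ → ℂ} {y w₁ w₂ : ℂ}
    (h₁ : IsContinuationValue f y w₁) (h₂ : IsContinuationValue f y w₂) : w₁ = w₂ := by
  obtain ⟨V, g, hVo, hVc, hV0, hVy, hg, hgf, rfl⟩ := h₁
  obtain ⟨W, k, hWo, hWc, hW0, hWy, hk, hkf, rfl⟩ := h₂
  have hg' : AnalyticOnNhd ℂ g (V ∩ W) :=
    (hg.mono inter_subset_left).analyticOnNhd (hVo.inter hWo)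
  have hk' : AnalyticOnNhd ℂ k (V ∩ W) :=
    (hk.mono inter_subset_right).analyticOnNhd (hVo.inter hWo)
  exact hg'.eqOn_of_preconnected_of_eventuallyEq hk' (hVc.inter hWc).isPreconnected
    ⟨hV0, hW0⟩ (hgf.trans hkf.symm) ⟨hVy, hWy⟩

open Classical in
/-- The value at `y` of the analytic continuation of `f` along the segment `[0, y]`
(with the value `0` if there is no such continuation). -/
def segmentContinuation (f : ℂ → ℂ) (y : ℂ) : ℂ :=
  if h : ∃ w, IsContinuationValue f y w then h.choose else 0

theorem IsContinuationValue.segmentContinuation_eq {f : ℂ → ℂ} {y w : ℂ}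
    (h : IsContinuationValue f y w) : segmentContinuation f y = w := by
  have h' : ∃ w, IsContinuationValue f y w := ⟨w, h⟩
  rw [segmentContinuation, dif_pos h']
  exact h'.choose_spec.unique h

/-! ### Appell's function `F₃` -/

/-- Appell's double series
`∑_{m,n} (α)_m (α')_n (β)_m (β')_n / (γ)_{m+n} · x^m / m! · y^n / n!`,
absolutely convergent for `max (|x|, |y|) < 1`. -/
def appellF3Series (α α' β β' γ x y : ℂ) : ℂ :=
  ∑' k : ℕ × ℕ, poch α k.1 * poch α' k.2 * poch β k.1 * poch β' k.2 / poch γ (k.1 + k.2) *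
    (x ^ k.1 / (k.1.factorial : ℂ)) * (y ^ k.2 / (k.2.factorial : ℂ))

/-- Appell's function `F₃` for `|x| < 1`: the sum of the double series, continued analytically in
the second variable along the segment from `0` to `y`. (In the kernel of the fractional integral
`x = 1 - t / z` lies in `(0, 1)`, while `y = 1 - z / t` runs through the whole negative axis.) -/
def appellF3 (α α' β β' γ x y : ℂ) : ℂ :=
  segmentContinuation (appellF3Series α α' β β' γ x) y

/-! ### The left-sided Saigo–Maeda fractional integral -/

/-- The integrand `(x - t)^(γ-1) t^(-α') F₃(α, α', β, β'; γ; 1 - t/x, 1 - x/t) f(t)`. -/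
def saigoMaedaIntegrand (α α' β β' γ : ℂ) (f : ℝ → ℂ) (x t : ℝ) : ℂ :=
  ((x - t : ℝ) : ℂ) ^ (γ - 1) * (t : ℂ) ^ (-α') *
    appellF3 α α' β β' γ ((1 - t / x : ℝ) : ℂ) ((1 - x / t : ℝ) : ℂ) * f t

/-- The defining integral of the left-sided fractional integral of `f` at `x` exists. -/
def SaigoMaedaExists (α α' β β' γ : ℂ) (f : ℝ → ℂ) (x : ℝ) : Prop :=
  MeasureTheory.IntegrableOn (saigoMaedaIntegrand α α' β β' γ f x) (Ioo 0 x)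

/-- The left-sided Saigo–Maeda fractional integral of `f` at `x`. -/
def saigoMaeda (α α' β β' γ : ℂ) (f : ℝ → ℂ) (x : ℝ) : ℂ :=
  (x : ℂ) ^ (-α) / Gamma γ * ∫ t in Ioo 0 x, saigoMaedaIntegrand α α' β β' γ f x t

/-! ### The generalized `M`-series and the `K`-function -/

/-- The `n`-th term of the `M`-series. -/
def mTerm {p q : ℕ} (a : Fin p → ℂ) (b : Fin q → ℂ) (ξ η w : ℂ) (n : ℕ) : ℂ :=
  (∏ i, poch (a i) n) / (∏ j, poch (b j) n) * (w ^ n / Gamma (ξ * n + η))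

/-- The generalized `M`-series `pM_q^{ξ,η}(a; b; w)`. -/
def mSeries {p q : ℕ} (a : Fin p → ℂ) (b : Fin q → ℂ) (ξ η w : ℂ) : ℂ :=
  ∑' n : ℕ, mTerm a b ξ η w n

/-- The `n`-th term of the `K`-function. -/
def kTerm {p q : ℕ} (a : Fin p → ℂ) (b : Fin q → ℂ) (ξ η ν w : ℂ) (n : ℕ) : ℂ :=
  (∏ i, poch (a i) n) / (∏ j, poch (b j) n) *
    (poch ν n / Gamma (ξ * n + η)) * (w ^ n / (n.factorial : ℂ))

/-- The `K`-function `pK_q^{ξ,η;ν}(a; b; w)`. -/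
def kFunction {p q : ℕ} (a : Fin p → ℂ) (b : Fin q → ℂ) (ξ η ν w : ℂ) : ℂ :=
  ∑' n : ℕ, kTerm a b ξ η ν w n

/-! ### The Fox–Wright function -/

/-- The `n`-th term of the Fox–Wright series with upper parameters `A i = (aᵢ, αᵢ)` and lower
parameters `B j = (bⱼ, βⱼ)`. Where `Γ(bⱼ + βⱼ n)` has a pole its reciprocal is `0`, which is also
what the library's conventions `Gamma (-m) = 0` and `x / 0 = 0` give. -/
def foxWrightTerm {p q : ℕ} (A : Fin p → ℂ × ℂ) (B : Fin q → ℂ × ℂ) (w : ℂ) (n : ℕ) : ℂ :=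
  (∏ i, Gamma ((A i).1 + (A i).2 * n)) / (∏ j, Gamma ((B j).1 + (B j).2 * n)) *
    (w ^ n / (n.factorial : ℂ))

/-- The Fox–Wright function `pψ_q(A; B; w)`. -/
def foxWright {p q : ℕ} (A : Fin p → ℂ × ℂ) (B : Fin q → ℂ × ℂ) (w : ℂ) : ℂ :=
  ∑' n : ℕ, foxWrightTerm A B w n

/-- The Fox–Wright series exists at `w`: no Gamma function in a numerator is evaluated at a
pole, and the series converges (absolutely). -/
def FoxWrightExists {p q : ℕ} (A : Fin p → ℂ × ℂ) (B : Fin q → ℂ × ℂ) (w : ℂ) : Prop :=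
  (∀ (i : Fin p) (n m : ℕ), (A i).1 + (A i).2 * n ≠ -(m : ℂ)) ∧
    Summable (foxWrightTerm A B w)

/-- Upper parameters `(aᵢ, 1)₁ᵖ, (σ, μ), (σ+γ-α-α'-β, μ), (σ+β'-α', μ), (κ, 1)`. -/
def upperParams {p : ℕ} (a : Fin p → ℂ) (α α' β β' γ σ κ : ℂ) (μ : ℝ) : Fin (p + 4) → ℂ × ℂ :=
  Fin.append (fun i => (a i, 1))
    ![(σ, (μ : ℂ)), (σ + γ - α - α' - β, (μ : ℂ)), (σ + β' - α', (μ : ℂ)), (κ, 1)]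

/-- Lower parameters `(bⱼ, 1)₁^q, (σ+γ-α-α', μ), (σ+γ-α'-β, μ), (σ+β', μ), (η, ξ)`. -/
def lowerParams {q : ℕ} (b : Fin q → ℂ) (α α' β β' γ σ η ξ : ℂ) (μ : ℝ) :
    Fin (q + 4) → ℂ × ℂ :=
  Fin.append (fun j => (b j, 1))
    ![(σ + γ - α - α', (μ : ℂ)), (σ + γ - α' - β, (μ : ℂ)), (σ + β', (μ : ℂ)), (η, ξ)]

end

/-! ### Pochhammer symbols -/

/-! The fractional integral multiplies `t ^ (s - 1)` by a power of `z` and a quotient of six Gamma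
functions, `saigoMultiplier`. Applied to each term of the `M`- or `K`-series, this produces the
Fox–Wright series. Two things need proof: the value of the multiplier, and the exchange of sum and
integral under the bare assumption that both sides exist.

Multiplier. Pfaff's transformation in the second variable writes `F₃` as `(1 - y) ^ (-α')` times a
double power series in `x` and `y / (y - 1)` (`appellF3_eq`). At `x = 1 - t / z`, `y = 1 - z / t`
these two arguments coincide, and the prefactor cancels the `t ^ (-α')` of the integrand. After
scaling to `(0, 1)` the kernel is `(1 - t) ^ (γ - 1)` times a power series in `1 - t`. For large `Re
s` its Mellin transform is a double sum of Beta integrals, evaluated by Gauss' theorem twice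
(`tsum_pfaffCoeff_mul_Gamma`). The identity theorem and a boundary limit carry the formula to every
`s` at which the integral converges absolutely and the upper Gamma functions have no pole
(`integral_saigoKernel_mul_cpow`).

Exchange (`integral_saigoKernel_mul_tsum`). Near `t = 0` a power series is comparable to its lowest
nonzero term, so integrability of the whole makes that term integrable, and the later ones are
geometrically smaller there. Near `t = 1` the `n`-th term is bounded by a Beta integrand whose
integral decays like `n ^ (-Re γ)`. The multiplier has the same rate, so convergence of the
Fox–Wright series itself gives the required summability. The behaviour of the kernel at `0` is never
computed. -/

@[simp] lemma poch_zero (a : ℂ) : poch a 0 = 1 := by simp [poch]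

lemma poch_succ (a : ℂ) (n : ℕ) : poch a (n + 1) = poch a n * (a + n) :=
  ascPochhammer_succ_eval n a

lemma poch_add (a : ℂ) (m n : ℕ) : poch a (m + n) = poch a m * poch (a + m) n := by
  induction n with
  | zero => simp
  | succ n ih => rw [← add_assoc, poch_succ, ih, poch_succ]; push_cast; ring

lemma poch_succ_left (a : ℂ) (n : ℕ) : poch a (n + 1) = a * poch (a + 1) n := by
  rw [add_comm n 1, poch_add]
  simp [poch_succ]

lemma poch_one (n : ℕ) : poch 1 n = n.factorial := by
  rw [poch, ascPochhammer_eval_one]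

lemma poch_ne_zero {a : ℂ} (ha : ∀ k : ℕ, a ≠ -k) (n : ℕ) : poch a n ≠ 0 := by
  induction n with
  | zero => simp
  | succ n ih =>
    rw [poch_succ]
    exact mul_ne_zero ih fun h => ha n (eq_neg_of_add_eq_zero_left h)

lemma ne_neg_natCast_of_re_pos {a : ℂ} (ha : 0 < a.re) (k : ℕ) : a ≠ -k := by
  rintro rfl
  have : (0 : ℝ) ≤ k := k.cast_nonneg
  simp at ha
  linarith

lemma poch_ne_zero_of_re_pos {a : ℂ} (ha : 0 < a.re) (n : ℕ) : poch a n ≠ 0 :=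
  poch_ne_zero (ne_neg_natCast_of_re_pos ha) n

lemma Gamma_add_natCast {a : ℂ} (ha : ∀ k : ℕ, a ≠ -k) (n : ℕ) :
    Gamma (a + n) = poch a n * Gamma a := by
  rw [poch, ← Gamma_add_nat_div_Gamma_eq a ha, div_mul_cancel₀ _ (Gamma_ne_zero ha)]

lemma add_natCast_ne_zero {c : ℂ} (hc : 0 < c.re) (n : ℕ) : c + n ≠ 0 := fun h =>
  ne_neg_natCast_of_re_pos hc n (eq_neg_of_add_eq_zero_left h)

lemma re_add_le_norm_add (c : ℂ) (n : ℕ) : c.re + n ≤ ‖c + n‖ := by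
  simpa using re_le_norm (c + n)

/-- Quotients of Pochhammer symbols grow at most polynomially, uniformly in the denominator. -/
lemma exists_norm_poch_sub_div_le (b : ℂ) {ρ : ℝ} (hρ : 0 < ρ) :
    ∃ D : ℕ, ∀ c : ℂ, ρ ≤ c.re → ∀ n : ℕ, ‖poch (c - b) n / poch c n‖ ≤ ((n : ℝ) + 1) ^ D := by
  -- This choice makes each new factor at most `1 + D / (n + 1)`, hence by Bernoulli at most `((n +
  -- 2) / (n + 1)) ^ D`; the product telescopes.
  obtain ⟨D, hD⟩ := exists_nat_ge (‖b‖ + ‖b‖ / ρ)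
  refine ⟨D, fun c hc n => ?_⟩
  induction n with
  | zero => simp
  | succ n ih =>
    have hcn : 0 < ρ + n := by positivity
    have hc0 : c + n ≠ 0 := add_natCast_ne_zero (hρ.trans_le hc) n
    rw [poch_succ, poch_succ, mul_div_mul_comm, norm_mul]
    have h1 : ‖(c - b + n) / (c + n)‖ ≤ 1 + ‖b‖ / (ρ + n) := by
      have : (c - b + n) / (c + n) = 1 - b / (c + n) := by field_simp; ring
      rw [this]
      refine (norm_sub_le _ _).trans ?_
      rw [norm_one, norm_div]
      have : ρ + n ≤ ‖c + n‖ := le_trans (by linarith) (re_add_le_norm_add c n)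
      gcongr
    have h2 : ‖b‖ / (ρ + n) ≤ D * (1 / ((n : ℝ) + 1)) := by
      rw [mul_one_div, div_le_div_iff₀ hcn (by positivity)]
      have h3 : ‖b‖ / ρ * ρ = ‖b‖ := div_mul_cancel₀ _ hρ.ne'
      have h4 : 0 ≤ ‖b‖ / ρ := by positivity
      have h5 : (‖b‖ + ‖b‖ / ρ) * (ρ + n) ≤ D * (ρ + n) := by gcongr
      nlinarith [norm_nonneg b, mul_nonneg h4 (Nat.cast_nonneg (α := ℝ) n),
        mul_nonneg (norm_nonneg b) hρ.le]
    have h3 := one_add_mul_le_pow (a := 1 / ((n : ℝ) + 1))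
      (le_trans (by norm_num) (show (0 : ℝ) ≤ _ by positivity)) D
    calc _ ≤ ((n : ℝ) + 1) ^ D * (1 + 1 / ((n : ℝ) + 1)) ^ D := by
          gcongr
          exact h1.trans (le_trans (by linarith) h3)
      _ = _ := by
          rw [← mul_pow]
          congr 1
          push_cast
          field_simp

lemma exists_norm_poch_div_le (a : ℂ) {c : ℂ} (hc : 0 < c.re) :
    ∃ D : ℕ, ∀ n : ℕ, ‖poch a n / poch c n‖ ≤ ((n : ℝ) + 1) ^ D := by
  obtain ⟨D, hD⟩ := exists_norm_poch_sub_div_le (c - a) hc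
  exact ⟨D, fun n => by simpa using hD c le_rfl n⟩

lemma exists_norm_poch_div_factorial_le (a : ℂ) :
    ∃ D : ℕ, ∀ n : ℕ, ‖poch a n / n.factorial‖ ≤ ((n : ℝ) + 1) ^ D := by
  obtain ⟨D, hD⟩ := exists_norm_poch_div_le a (c := 1) (by simp)
  exact ⟨D, fun n => by simpa [poch_one] using hD n⟩

/-- Quotients of Pochhammer symbols decay at any polynomial rate if the real part of the
denominator is large. -/
lemma exists_norm_poch_div_le_of_le_re (b : ℂ) (E : ℕ) :
    ∃ L C : ℝ, 0 < L ∧ 0 ≤ C ∧ ∀ c : ℂ, L ≤ c.re → ∀ n : ℕ,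
      ‖poch b n / poch c n‖ ≤ C * (((n : ℝ) + 1) ^ E)⁻¹ := by
  -- With `Re c ≥ B + E * B` each new factor is at most `1 - E / (n + B + 1)`, hence by Bernoulli at
  -- most `((n + B) / (n + B + 1)) ^ E`. The comparison needs `‖b‖ ≤ B` and `E + 1 ≤ B`. Telescoping
  -- yields `B ^ E / (n + B) ^ E`.
  obtain ⟨B, hB⟩ := exists_nat_ge (‖b‖ + E + 1)
  have hE : (0 : ℝ) ≤ E := E.cast_nonneg
  have hB1 : (1 : ℝ) ≤ B := by linarith [norm_nonneg b]
  have hbB : ‖b‖ ≤ B := by linarith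
  refine ⟨B + E * B, (B : ℝ) ^ E, by positivity, by positivity, fun c hc n => ?_⟩
  have hc0 : 0 < c.re := lt_of_lt_of_le (by positivity) hc
  suffices h : ‖poch b n / poch c n‖ ≤ (B : ℝ) ^ E * (((n : ℝ) + B) ^ E)⁻¹ by
    refine h.trans ?_
    gcongr
  induction n with
  | zero => simp [show (B : ℝ) ≠ 0 by positivity]
  | succ n ih =>
    have hn : (0 : ℝ) ≤ n := n.cast_nonneg
    rw [poch_succ, poch_succ, mul_div_mul_comm, norm_mul]
    have h1 : ‖(b + n) / (c + n)‖ ≤ (B + n) / (B + E * B + n) := by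
      rw [norm_div]
      have h2 : B + E * B + n ≤ ‖c + n‖ := le_trans (by linarith) (re_add_le_norm_add c n)
      have h3 : ‖b + n‖ ≤ B + n := (norm_add_le _ _).trans (by simpa using hbB)
      gcongr
    have h2 : (B + n) / (B + E * B + n) ≤ 1 + E * (-(1 / ((n : ℝ) + B + 1))) := by
      have : (1 : ℝ) + E * (-(1 / ((n : ℝ) + B + 1))) = (n + B + 1 - E) / (n + B + 1) := by
        field_simp; ring
      rw [this, div_le_div_iff₀ (by positivity) (by positivity)]
      have h3 : 0 ≤ (E : ℝ) * n * (B - 1) :=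
        mul_nonneg (mul_nonneg hE hn) (by linarith)
      have h4 : 0 ≤ (E : ℝ) * B * (B - E - 1) :=
        mul_nonneg (mul_nonneg hE (by linarith)) (by linarith [norm_nonneg b])
      nlinarith [mul_nonneg hE hn, mul_nonneg hE (show (0:ℝ) ≤ B by linarith)]
    have h3 := one_add_mul_le_pow (a := -(1 / ((n : ℝ) + B + 1))) (by
      have : 1 / ((n : ℝ) + B + 1) ≤ 1 := by rw [div_le_one (by positivity)]; linarith
      linarith) E
    calc _ ≤ (B : ℝ) ^ E * (((n : ℝ) + B) ^ E)⁻¹ * (1 + -(1 / ((n : ℝ) + B + 1))) ^ E := by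
          gcongr
          exact h1.trans (h2.trans h3)
      _ = _ := by
          have : 1 + -(1 / ((n : ℝ) + B + 1)) = (n + B) / (n + B + 1) := by field_simp; ring
          rw [this, div_pow]
          push_cast
          rw [show (n : ℝ) + 1 + B = n + B + 1 by ring]
          have : ((n : ℝ) + B) ^ E ≠ 0 := by positivity
          field_simp

/-! ### Elementary summability -/

lemma summable_add_one_pow_mul_geometric (D : ℕ) {r : ℝ} (h0 : 0 ≤ r) (h1 : r < 1) :
    Summable fun n : ℕ => ((n : ℝ) + 1) ^ D * r ^ n := by
  rcases h0.eq_or_lt with rfl | h0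
  · refine summable_of_ne_finset_zero (s := {0}) fun n hn => ?_
    simp [show n ≠ 0 by simpa using hn]
  have h := (summable_nat_add_iff 1).2
    (summable_pow_mul_geometric_of_norm_lt_one (R := ℝ) D (r := r)
      (by rwa [Real.norm_of_nonneg h0.le]))
  refine (h.mul_left r⁻¹).congr fun n => ?_
  push_cast
  field_simp
  ring

lemma summable_add_one_inv_sq : Summable fun n : ℕ => (((n : ℝ) + 1) ^ 2)⁻¹ := by
  have := (summable_nat_add_iff 1).2 (Real.summable_nat_pow_inv.2 (show 1 < 2 by norm_num))
  simpa using this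

lemma summable_prod_of_norm_le {F : ℕ × ℕ → ℂ} {f g : ℕ → ℝ} (hf : Summable f) (hg : Summable g)
    (hf0 : ∀ n, 0 ≤ f n) (hg0 : ∀ n, 0 ≤ g n) (h : ∀ m n, ‖F (m, n)‖ ≤ f m * g n) : Summable F :=
  Summable.of_norm_bounded (hf.mul_of_nonneg hg hf0 hg0) fun k => h k.1 k.2

/-! ### The Chu–Vandermonde sum and Pfaff's transformation -/

/-- Induction by Pascal's rule: the shifted half of the sum is the same sum for `d + 1` and `c + 1`,
which is why `d` and `c` are quantified after `N`. -/
lemma chu_vandermonde (N : ℕ) : ∀ (d : ℂ) {c : ℂ}, 0 < c.re →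
    ∑ i ∈ Finset.range (N + 1), (N.choose i : ℂ) * ((-1) ^ i * (poch d i / poch c i)) =
      poch (c - d) N / poch c N := by
  induction N with
  | zero => simp
  | succ N ih =>
    intro d c hc
    have hc1 : 0 < (c + 1).re := by simp; linarith
    have hc0 : c ≠ 0 := by simpa using add_natCast_ne_zero hc 0
    have h := Finset.sum_choose_succ_mul
      (fun i _ => (-1 : ℂ) ^ i * (poch d i / poch c i)) N
    rw [h, ih d hc]
    have h2 : ∀ i ∈ Finset.range (N + 1),
        (N.choose i : ℂ) * ((-1) ^ (i + 1) * (poch d (i + 1) / poch c (i + 1))) =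
          -(d / c) * ((N.choose i : ℂ) * ((-1) ^ i * (poch (d + 1) i / poch (c + 1) i))) := by
      intro i _
      rw [poch_succ_left, poch_succ_left, mul_div_mul_comm]
      ring
    rw [Finset.sum_congr rfl h2, ← Finset.mul_sum, ih (d + 1) hc1]
    have h3 : c * poch (c + 1) N = poch c N * (c + N) := by rw [← poch_succ_left, poch_succ]
    have h4 := poch_ne_zero_of_re_pos hc N
    have h5 := add_natCast_ne_zero hc N
    have h6 : poch (c + 1) N = poch c N * (c + N) / c := by rw [← h3]; field_simp
    rw [show c + 1 - (d + 1) = c - d by ring, h6, poch_succ, poch_succ]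
    field_simp
    ring

lemma hasSum_poch_div_factorial_mul_pow (a : ℂ) {y : ℂ} (hy : ‖y‖ < 1) :
    HasSum (fun n : ℕ => poch a n / n.factorial * y ^ n) ((1 - y) ^ (-a)) := by
  have h := (one_div_one_sub_cpow_hasFPowerSeriesOnBall_zero a).hasSum (y := y) (by
    rw [← ENNReal.ofReal_one, Metric.eball_ofReal]
    simpa using hy)
  simp only [FormalMultilinearSeries.ofScalars_apply_eq, zero_add, smul_eq_mul] at h
  rw [cpow_neg, ← one_div]
  refine (congrArg (fun f => HasSum f _) (funext fun n => ?_)).mp h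
  have h1 := Ring.factorial_nsmul_multichoose_eq_ascPochhammer a n
  rw [Polynomial.ascPochhammer_smeval_eq_eval, Ring.multichoose_eq, nsmul_eq_mul] at h1
  have h2 : (n.factorial : ℂ) ≠ 0 := by exact_mod_cast n.factorial_ne_zero
  rw [poch, ← h1]
  field_simp

lemma tsum_prod_eq_tsum_sum_range {F : ℕ × ℕ → ℂ} (hF : Summable F) :
    ∑' k, F k = ∑' N : ℕ, ∑ i ∈ Finset.range (N + 1), F (i, N - i) := by
  rw [← Finset.HasAntidiagonal.sigmaAntidiagonalEquivProd.tsum_eq F]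
  have h := (Finset.HasAntidiagonal.sigmaAntidiagonalEquivProd.summable_iff (f := F)).2 hF
  refine (h.tsum_sigma' fun N => (hasSum_fintype _).summable).trans ?_
  refine tsum_congr fun N => ?_
  rw [tsum_fintype, ← Finset.Nat.sum_antidiagonal_eq_sum_range_succ_mk,
    ← Finset.sum_coe_sort (Finset.HasAntidiagonal.antidiagonal N)]
  rfl

/-- Expanding `(1 - y) ^ (-a - n)` on the right by the binomial series gives a double series; summed
along diagonals it collapses to the left side by Chu–Vandermonde. A small disc suffices, because the
identity is used only for germs at `0`. -/
lemma tsum_poch_mul_pow_pfaff (a b : ℂ) {c y : ℂ} (hc : 0 < c.re) (hy : ‖y‖ < 1 / 3) :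
    ∑' n : ℕ, poch a n / n.factorial * (poch b n / poch c n) * y ^ n =
      (1 - y) ^ (-a) *
        ∑' n : ℕ, poch a n / n.factorial * (poch (c - b) n / poch c n) * (y / (y - 1)) ^ n := by
  set F : ℕ × ℕ → ℂ := fun k => poch a (k.1 + k.2) / (k.1.factorial * k.2.factorial) *
    (poch (c - b) k.1 / poch c k.1) * ((-1) ^ k.1 * y ^ (k.1 + k.2)) with hFdef
  have hy1 : 1 - y ≠ 0 := by
    intro h
    rw [← sub_eq_zero.1 h] at hy
    norm_num at hy
  have hr : 2 * ‖y‖ < 1 := by linarith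
  have hF : Summable F := by
    obtain ⟨D₁, hD₁⟩ := exists_norm_poch_div_factorial_le a
    obtain ⟨D₂, hD₂⟩ := exists_norm_poch_div_le (c - b) hc
    refine summable_prod_of_norm_le
      (summable_add_one_pow_mul_geometric (D₁ + D₂) (by positivity) hr)
      (summable_add_one_pow_mul_geometric D₁ (by positivity) hr)
      (fun n => by positivity) (fun n => by positivity) fun m n => ?_
    have h1 : poch a (m + n) / (m.factorial * n.factorial) =
        poch a (m + n) / (m + n).factorial * ((m + n).choose m : ℂ) := by
      have h2 : ((m + n).choose m : ℂ) * m.factorial * n.factorial = (m + n).factorial := by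
        rw [Nat.choose_symm_add]; exact_mod_cast Nat.add_choose_mul_factorial_mul_factorial m n
      have h3 : (m.factorial : ℂ) ≠ 0 := by exact_mod_cast m.factorial_ne_zero
      have h4 : (n.factorial : ℂ) ≠ 0 := by exact_mod_cast n.factorial_ne_zero
      have h5 : ((m + n).factorial : ℂ) ≠ 0 := by exact_mod_cast (m + n).factorial_ne_zero
      rw [← h2] at h5 ⊢
      have h6 : ((m + n).choose m : ℂ) ≠ 0 := by
        intro h; simp [h] at h5
      field_simp
    -- The binomial coefficient costs `2 ^ (m + n)`, so absolute convergence rests on `2 * ‖y‖ < 1`.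
    have h2 : (((m + n).choose m : ℕ) : ℝ) ≤ 2 ^ (m + n) := by
      exact_mod_cast Nat.choose_le_two_pow (m + n) m
    have h3 : ((m + n : ℕ) : ℝ) + 1 ≤ ((m : ℝ) + 1) * (n + 1) := by
      push_cast
      nlinarith [mul_nonneg (Nat.cast_nonneg (α := ℝ) m) (Nat.cast_nonneg (α := ℝ) n)]
    calc ‖F (m, n)‖ = ‖poch a (m + n) / (m + n).factorial‖ * ((m + n).choose m : ℕ) *
          ‖poch (c - b) m / poch c m‖ * ‖y‖ ^ (m + n) := by
          simp only [hFdef, h1, norm_mul, norm_pow, norm_neg, norm_one, one_pow, one_mul,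
            Complex.norm_natCast]
      _ ≤ (((m : ℝ) + 1) * (n + 1)) ^ D₁ * 2 ^ (m + n) * ((m : ℝ) + 1) ^ D₂ * ‖y‖ ^ (m + n) := by
          gcongr
          · exact (hD₁ _).trans (by gcongr)
          · exact hD₂ m
      _ = _ := by rw [mul_pow, mul_pow, mul_pow]; ring
  have h1 := tsum_prod_eq_tsum_sum_range hF
  rw [hF.tsum_prod] at h1
  have h2 : ∀ N : ℕ, ∑ i ∈ Finset.range (N + 1), F (i, N - i) =
      poch a N / N.factorial * (poch b N / poch c N) * y ^ N := by
    intro N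
    have h3 := chu_vandermonde N (c - b) hc
    rw [sub_sub_cancel] at h3
    rw [← h3, Finset.mul_sum, Finset.sum_mul]
    refine Finset.sum_congr rfl fun i hi => ?_
    have hi : i ≤ N := Nat.lt_succ_iff.1 (Finset.mem_range.1 hi)
    have h4 : (N.choose i : ℂ) * i.factorial * (N - i).factorial = N.factorial := by
      exact_mod_cast Nat.choose_mul_factorial_mul_factorial hi
    have h5 : (i.factorial : ℂ) ≠ 0 := by exact_mod_cast i.factorial_ne_zero
    have h6 : ((N - i).factorial : ℂ) ≠ 0 := by exact_mod_cast (N - i).factorial_ne_zero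
    have h7 : (N.factorial : ℂ) ≠ 0 := by exact_mod_cast N.factorial_ne_zero
    have h8 : (N.choose i : ℂ) ≠ 0 := by
      intro h; rw [h] at h4; simp at h4; exact h7 h4.symm
    simp only [hFdef, Nat.add_sub_cancel' hi, ← h4]
    field_simp
  have h3 : ∀ n : ℕ, ∑' k : ℕ, F (n, k) = (1 - y) ^ (-a) *
      (poch a n / n.factorial * (poch (c - b) n / poch c n) * (y / (y - 1)) ^ n) := by
    intro n
    have h4 := (hasSum_poch_div_factorial_mul_pow (a + n) (y := y) (by linarith)).tsum_eq
    have h5 : (1 - y) ^ (-(a + n)) = (1 - y) ^ (-a) * ((1 - y) ^ n)⁻¹ := by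
      rw [neg_add, cpow_add _ _ hy1, cpow_neg, cpow_neg, cpow_natCast]
    have h6 : ∀ k : ℕ, F (n, k) = poch a n / n.factorial * (poch (c - b) n / poch c n) *
        ((-1) ^ n * y ^ n) * (poch (a + n) k / k.factorial * y ^ k) := by
      intro k
      simp only [hFdef, poch_add, pow_add]
      ring
    have h7 : (y / (y - 1)) ^ n = (-1) ^ n * y ^ n * ((1 - y) ^ n)⁻¹ := by
      rw [← mul_pow, ← inv_pow, ← mul_pow]
      congr 1
      have : y - 1 ≠ 0 := by rwa [← neg_sub, neg_ne_zero]
      field_simp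
      ring
    rw [tsum_congr h6, tsum_mul_left, h4, h5, h7]
    ring
  rw [tsum_congr h2, tsum_congr h3, tsum_mul_left] at h1
  exact h1.symm

/-! ### Asymptotics of quotients of Gamma functions -/

/-- The Beta integral after the substitution `v = x t`. The indicator keeps the domain independent
of `x`, ready for dominated convergence as `x → ∞`. -/
lemma integral_one_sub_div_cpow_mul_cpow {a d : ℂ} (hd : 0 < d.re) {x : ℝ} (hx : 0 < x)
    (hxa : 0 < x + a.re) :
    ∫ v in Ioi (0 : ℝ), (Ioo 0 x).indicator
        (fun v : ℝ => ((1 - v / x : ℝ) : ℂ) ^ (x + a - 1) * (v : ℂ) ^ (d - 1)) v =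
      (x : ℂ) ^ d * (Gamma d * Gamma (x + a) / Gamma (x + a + d)) := by
  have h := betaIntegral_scaled d (x + a) hx
  rw [betaIntegral_eq_Gamma_mul_div d (x + a) hd (by simpa using hxa)] at h
  have hx0 : (x : ℂ) ≠ 0 := ofReal_ne_zero.2 hx.ne'
  rw [MeasureTheory.setIntegral_indicator measurableSet_Ioo,
    inter_eq_self_of_subset_right Ioo_subset_Ioi_self]
  rw [intervalIntegral.integral_of_le hx.le, MeasureTheory.integral_Ioc_eq_integral_Ioo] at h
  have h1 : (x : ℂ) ^ (d + (x + a) - 1) = (x : ℂ) ^ d * (x : ℂ) ^ (x + a - 1) := by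
    rw [← cpow_add _ _ hx0]; ring_nf
  have h2 : (x : ℂ) ^ (x + a - 1) ≠ 0 := by simp [cpow_eq_zero_iff, hx0]
  rw [h1] at h
  refine mul_left_cancel₀ h2 ?_
  rw [← MeasureTheory.integral_const_mul]
  refine Eq.trans ?_ (h.trans ?_)
  · refine MeasureTheory.setIntegral_congr_fun measurableSet_Ioo fun v hv => ?_
    have h3 : (0 : ℝ) ≤ 1 - v / x := by
      rw [sub_nonneg, div_le_one hx]; exact hv.2.le
    have h4 : (x : ℂ) - v = ((x : ℝ) : ℂ) * ((1 - v / x : ℝ) : ℂ) := by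
      push_cast; field_simp
    rw [h4, mul_cpow_ofReal_nonneg hx.le h3]
    ring
  · rw [add_comm d]; ring

/-- In the rescaled Beta integral `(1 - v / x) ^ (x + a - 1)` tends to `exp (-v)`, so the limit is
the Euler integral of `Γ(d)`. -/
lemma tendsto_cpow_mul_Gamma_div_Gamma_add (a : ℂ) {d : ℂ} (hd : 0 < d.re) :
    Tendsto (fun x : ℝ => (x : ℂ) ^ d * (Gamma (x + a) / Gamma (x + a + d))) atTop (𝓝 1) := by
  have key : Tendsto (fun x : ℝ => ∫ v in Ioi (0 : ℝ), (Ioo 0 x).indicator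
      (fun v : ℝ => ((1 - v / x : ℝ) : ℂ) ^ (x + a - 1) * (v : ℂ) ^ (d - 1)) v) atTop
      (𝓝 (∫ v in Ioi (0 : ℝ), (Real.exp (-v) : ℂ) * (v : ℂ) ^ (d - 1))) := by
    refine MeasureTheory.tendsto_integral_filter_of_dominated_convergence
      (fun v : ℝ => v ^ (d.re - 1) * Real.exp (-(1 / 2) * v ^ (1 : ℝ))) ?_ ?_ ?_ ?_
    · refine Eventually.of_forall fun x => ?_
      refine Measurable.aestronglyMeasurable ?_
      refine Measurable.indicator ?_ measurableSet_Ioo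
      fun_prop
    -- The threshold gives `x + Re a - 1 ≥ x / 2`, whence the majorant `exp (-v / 2)`.
    · filter_upwards [eventually_gt_atTop 0, eventually_ge_atTop (2 * (1 - a.re))] with x hx hxa
      filter_upwards [MeasureTheory.ae_restrict_mem measurableSet_Ioi] with v hv
      have hv : 0 < v := hv
      by_cases hvx : v ∈ Ioo 0 x
      · have h3 : (0 : ℝ) < 1 - v / x := by
          rw [sub_pos, div_lt_one hx]; exact hvx.2
        rw [indicator_of_mem hvx, norm_mul, norm_cpow_eq_rpow_re_of_pos h3,
          norm_cpow_eq_rpow_re_of_pos hv, mul_comm, Real.rpow_one]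
        have h4 : 0 ≤ x + a.re - 1 := by linarith
        have h5 : (1 - v / x) ^ (x + a.re - 1) ≤ Real.exp (-(1 / 2) * v) := by
          calc (1 - v / x) ^ (x + a.re - 1) ≤ (Real.exp (-(v / x))) ^ (x + a.re - 1) :=
                Real.rpow_le_rpow h3.le (Real.one_sub_le_exp_neg _) h4
            _ = Real.exp (-(v / x) * (x + a.re - 1)) := (Real.exp_mul _ _).symm
            _ ≤ _ := by
              rw [Real.exp_le_exp]
              have h6 : v / x * (x / 2) ≤ v / x * (x + a.re - 1) := by
                gcongr; linarith
              have h7 : v / x * (x / 2) = v / 2 := by field_simp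
              linarith
        simp only [sub_re, add_re, ofReal_re, one_re]
        gcongr
      · rw [indicator_of_notMem hvx, norm_zero]
        positivity
    · exact integrableOn_rpow_mul_exp_neg_mul_rpow (by linarith) one_pos (by norm_num)
    · filter_upwards [MeasureTheory.ae_restrict_mem measurableSet_Ioi] with v hv
      have hv : 0 < v := hv
      have h1 : Tendsto (fun x : ℝ => (((1 - v / x) ^ x : ℝ) : ℂ)) atTop (𝓝 (Real.exp (-v) : ℂ)) := by
        have := Real.tendsto_one_add_div_rpow_exp (-v)
        simp only [neg_div, ← sub_eq_add_neg] at this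
        exact (continuous_ofReal.tendsto _).comp this
      have h2 : Tendsto (fun x : ℝ => ((1 - v / x : ℝ) : ℂ) ^ (a - 1)) atTop (𝓝 1) := by
        have h3 : Tendsto (fun x : ℝ => ((1 - v / x : ℝ) : ℂ)) atTop (𝓝 1) := by
          have h4 : Tendsto (fun x : ℝ => 1 - v / x) atTop (𝓝 (1 - 0)) :=
            tendsto_const_nhds.sub (tendsto_const_nhds.div_atTop tendsto_id)
          rw [sub_zero] at h4
          simpa [Function.comp_def] using (continuous_ofReal.tendsto _).comp h4
        have h5 := (continuousAt_cpow_const (a := 1) (b := a - 1) (by simp)).tendsto.comp h3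
        simpa [Function.comp_def] using h5
      have h3 := (h1.mul h2).mul_const ((v : ℂ) ^ (d - 1))
      rw [mul_one] at h3
      refine h3.congr' ?_
      filter_upwards [eventually_gt_atTop v] with x hx
      have hx0 : 0 < x := hv.trans hx
      have h4 : (0 : ℝ) < 1 - v / x := by rw [sub_pos, div_lt_one hx0]; exact hx
      rw [indicator_of_mem (show v ∈ Ioo 0 x from ⟨hv, hx⟩), add_sub_assoc,
        cpow_add _ _ (ofReal_ne_zero.2 h4.ne'), ofReal_cpow h4.le]
  have hG : ∫ v in Ioi (0 : ℝ), (Real.exp (-v) : ℂ) * (v : ℂ) ^ (d - 1) = Gamma d := by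
    rw [Gamma_eq_integral hd, GammaIntegral]
  rw [hG] at key
  have hG0 := Gamma_ne_zero_of_re_pos hd
  have h := key.div_const (Gamma d)
  rw [div_self hG0] at h
  refine h.congr' ?_
  filter_upwards [eventually_gt_atTop 0, eventually_gt_atTop (-a.re)] with x hx hxa
  rw [integral_one_sub_div_cpow_mul_cpow hd hx (by linarith)]
  field_simp

/-- `Γ(x + p) / Γ(x + q) ∼ x ^ (p - q)` as `x → ∞` along the reals. -/
lemma tendsto_cpow_mul_Gamma_div_Gamma (p q : ℂ) :
    Tendsto (fun x : ℝ => (x : ℂ) ^ (q - p) * (Gamma (x + p) / Gamma (x + q))) atTop (𝓝 1) := by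
  -- `D` lies to the right of both `p` and `q`; the claim is the quotient of the asymptotics of `Γ(x
  -- + p) / Γ(x + D)` and `Γ(x + q) / Γ(x + D)`.
  set D : ℂ := ((max p.re q.re + 1 : ℝ) : ℂ) with hD
  have hDp : 0 < (D - p).re := by
    have := le_max_left p.re q.re
    rw [sub_re, hD, ofReal_re]; linarith
  have hDq : 0 < (D - q).re := by
    have := le_max_right p.re q.re
    rw [sub_re, hD, ofReal_re]; linarith
  have h := (tendsto_cpow_mul_Gamma_div_Gamma_add p hDp).div
    (tendsto_cpow_mul_Gamma_div_Gamma_add q hDq) one_ne_zero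
  rw [div_one] at h
  refine h.congr' ?_
  filter_upwards [eventually_gt_atTop 0, eventually_gt_atTop (-D.re)] with x hx hxD
  have hx0 : (x : ℂ) ≠ 0 := ofReal_ne_zero.2 hx.ne'
  have h1 : Gamma (x + D) ≠ 0 := Gamma_ne_zero_of_re_pos (by rw [add_re, ofReal_re]; linarith)
  have h2 : (x : ℂ) ^ (D - q) ≠ 0 := by simp [cpow_eq_zero_iff, hx0]
  have h3 : (x : ℂ) ^ (q - p) = (x : ℂ) ^ (D - p) / (x : ℂ) ^ (D - q) := by
    rw [← cpow_sub _ _ hx0]; ring_nf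
  simp only [Pi.div_apply, add_assoc, add_sub_cancel]
  rw [h3]
  field_simp

lemma tendsto_natCast_cpow_mul_Gamma_div_Gamma (p q : ℂ) :
    Tendsto (fun n : ℕ => (n : ℂ) ^ (q - p) * (Gamma (n + p) / Gamma (n + q))) atTop (𝓝 1) := by
  simpa using! (tendsto_cpow_mul_Gamma_div_Gamma p q).comp tendsto_natCast_atTop_atTop

lemma isBigO_Gamma_div_Gamma (p q : ℂ) :
    (fun n : ℕ => Gamma (n + p) / Gamma (n + q)) =O[atTop] fun n : ℕ => (n : ℝ) ^ (p.re - q.re) := by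
  have h := (tendsto_natCast_cpow_mul_Gamma_div_Gamma p q).isBigO_one ℝ
  obtain ⟨C, hC⟩ := h.bound
  refine Asymptotics.IsBigO.of_bound C ?_
  filter_upwards [hC, eventually_gt_atTop 0] with n hn hn0
  have hn1 : (0 : ℝ) < n := by exact_mod_cast hn0
  rw [norm_mul, norm_natCast_cpow_of_pos hn0, norm_one, mul_one, sub_re] at hn
  rw [Real.norm_of_nonneg (by positivity), ← neg_sub q.re, Real.rpow_neg hn1.le,
    ← div_eq_mul_inv, le_div_iff₀ (by positivity), mul_comm]
  exact hn

/-! ### Gauss' summation theorem -/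

lemma isBigO_poch_div_poch (a : ℂ) {c : ℂ} (hc : 0 < c.re) :
    (fun n : ℕ => poch a n / poch c n) =O[atTop] fun n : ℕ => (n : ℝ) ^ (a.re - c.re) := by
  by_cases ha : ∀ k : ℕ, a ≠ -k
  · have h := (isBigO_Gamma_div_Gamma a c).const_mul_left (Gamma c / Gamma a)
    refine h.congr_left fun n => ?_
    have hc' := ne_neg_natCast_of_re_pos hc
    rw [add_comm _ a, add_comm _ c, Gamma_add_natCast ha, Gamma_add_natCast hc']
    have h1 := Gamma_ne_zero ha
    have h2 := Gamma_ne_zero hc'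
    have h3 := poch_ne_zero hc' n
    field_simp
  -- Here `Γ(a)` has a pole, but the Pochhammer symbol vanishes from some index on.
  · push Not at ha
    obtain ⟨k, rfl⟩ := ha
    refine Asymptotics.IsBigO.of_bound 0 ?_
    filter_upwards [eventually_gt_atTop k] with n hn
    rw [poch, ascPochhammer_eval_neg_coe_nat_of_lt hn]
    simp

/-- The `n`-th term of Gauss' hypergeometric series at `1`. -/
noncomputable def gaussTerm (a b c : ℂ) (n : ℕ) : ℂ := poch a n / n.factorial * (poch b n / poch c n)

lemma isBigO_gaussTerm (a b : ℂ) {c : ℂ} (hc : 0 < c.re) :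
    gaussTerm a b c =O[atTop] fun n : ℕ => (n : ℝ) ^ (a.re + b.re - c.re - 1) := by
  have h := (isBigO_poch_div_poch a (c := 1) (by simp)).mul (isBigO_poch_div_poch b hc)
  refine (h.congr_left fun n => by rw [poch_one, gaussTerm]).trans_eventuallyEq ?_
  filter_upwards [eventually_gt_atTop 0] with n hn
  rw [← Real.rpow_add (by exact_mod_cast hn)]
  congr 1
  simp; ring

lemma summable_gaussTerm {a b c : ℂ} (hc : 0 < c.re) (h : 0 < (c - a - b).re) :
    Summable (gaussTerm a b c) := by
  refine summable_of_isBigO_nat (Real.summable_nat_rpow.2 ?_) (isBigO_gaussTerm a b hc)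
  simp at h
  linarith

lemma tendsto_natCast_mul_gaussTerm {a b c : ℂ} (hc : 0 < c.re) (h : 0 < (c - a - b).re) :
    Tendsto (fun n : ℕ => n * gaussTerm a b c n) atTop (𝓝 0) := by
  have h1 : (fun n : ℕ => (n : ℂ) * gaussTerm a b c n) =O[atTop]
      fun n : ℕ => (n : ℝ) ^ (-(c - a - b).re) := by
    have h2 : (fun n : ℕ => (n : ℂ)) =O[atTop] fun n : ℕ => (n : ℝ) :=
      Asymptotics.isBigO_of_le _ fun n => by simp
    refine (h2.mul (isBigO_gaussTerm a b hc)).trans_eventuallyEq ?_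
    filter_upwards [eventually_gt_atTop 0] with n hn
    rw [← Real.rpow_one_add' (by positivity)]
    · congr 1; simp; ring
    · simp at h ⊢; intro h'; linarith
  exact h1.trans_tendsto ((tendsto_rpow_neg_atTop h).comp tendsto_natCast_atTop_atTop)

/-- The contiguous relation between `c` and `c + 1`, termwise: the defect is the increment of `c * n
* gaussTerm a b c n`, so on summation only a boundary term tending to `0` remains. -/
lemma gaussTerm_telescope (a b : ℂ) {c : ℂ} (hc : 0 < c.re) (n : ℕ) :
    (c - a) * (c - b) * gaussTerm a b (c + 1) n - c * (c - a - b) * gaussTerm a b c n =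
      c * ((n + 1 : ℕ) * gaussTerm a b c (n + 1)) - c * (n * gaussTerm a b c n) := by
  have h1 := poch_ne_zero_of_re_pos hc n
  have h2 := add_natCast_ne_zero hc n
  have hc0 : c ≠ 0 := by simpa using add_natCast_ne_zero hc 0
  have h3 : poch (c + 1) n = poch c n * (c + n) / c := by
    rw [← poch_succ, poch_succ_left]; field_simp
  have h4 : (n.factorial : ℂ) ≠ 0 := by exact_mod_cast n.factorial_ne_zero
  have h5 : ((n + 1 : ℕ) : ℂ) ≠ 0 := by exact_mod_cast n.succ_ne_zero
  simp only [gaussTerm, h3, poch_succ, Nat.factorial_succ, Nat.cast_mul]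
  field_simp
  ring

lemma tsum_gaussTerm_succ {a b c : ℂ} (hc : 0 < c.re) (h : 0 < (c - a - b).re) :
    c * (c - a - b) * ∑' n, gaussTerm a b c n =
      (c - a) * (c - b) * ∑' n, gaussTerm a b (c + 1) n := by
  have hc1 : 0 < (c + 1).re := by simp; linarith
  have h1 : 0 < (c + 1 - a - b).re := by simp at h ⊢; linarith
  have hs := (summable_gaussTerm hc h).mul_left (c * (c - a - b))
  have hs1 := (summable_gaussTerm hc1 h1).mul_left ((c - a) * (c - b))
  have h2 := (hs1.sub hs).hasSum.tendsto_sum_nat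
  have h3 : Tendsto (fun N : ℕ => c * (N * gaussTerm a b c N)) atTop (𝓝 0) := by
    simpa using (tendsto_natCast_mul_gaussTerm hc h).const_mul c
  have h4 : ∀ N : ℕ, ∑ n ∈ Finset.range N, ((c - a) * (c - b) * gaussTerm a b (c + 1) n -
      c * (c - a - b) * gaussTerm a b c n) = c * (N * gaussTerm a b c N) := by
    intro N
    rw [Finset.sum_congr rfl fun n _ => gaussTerm_telescope a b hc n,
      Finset.sum_range_sub fun n : ℕ => c * (n * gaussTerm a b c n)]
    simp
  rw [funext h4] at h2
  have h5 := tendsto_nhds_unique h2 h3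
  rw [hs1.tsum_sub hs, tsum_mul_left, tsum_mul_left, sub_eq_zero] at h5
  exact h5.symm

/-- Shifting the denominator to the right only shrinks the terms, so the series for `c` dominates
all series for `c + N`. -/
lemma norm_poch_le_norm_poch_add_natCast {c : ℂ} (hc : 0 < c.re) (N n : ℕ) :
    ‖poch c n‖ ≤ ‖poch (c + N) n‖ := by
  induction n with
  | zero => simp
  | succ n ih =>
    rw [poch_succ, poch_succ, norm_mul, norm_mul]
    refine mul_le_mul ih ?_ (norm_nonneg _) (norm_nonneg _)
    rw [norm_def, norm_def]
    refine Real.sqrt_le_sqrt ?_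
    simp only [normSq_apply, add_re, natCast_re, add_im, natCast_im, add_zero]
    have hN : (0 : ℝ) ≤ N := N.cast_nonneg
    have hn : (0 : ℝ) ≤ n := n.cast_nonneg
    nlinarith [mul_nonneg hN hn, mul_nonneg hN hc.le, mul_nonneg hN hN]

lemma tendsto_poch_add_natCast {c : ℂ} (hc : 0 < c.re) (n : ℕ) :
    Tendsto (fun N : ℕ => (poch (c + N) (n + 1))⁻¹) atTop (𝓝 0) := by
  have h1 : Tendsto (fun N : ℕ => (c + N)⁻¹) atTop (𝓝 0) := by
    refine tendsto_inv₀_cobounded.comp (tendsto_norm_atTop_iff_cobounded.1 ?_)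
    refine tendsto_atTop_mono (fun N => (le_add_of_nonneg_left hc.le).trans (re_add_le_norm_add c N))
      tendsto_natCast_atTop_atTop
  have h2 : ∀ N : ℕ, ‖(poch (c + N) (n + 1))⁻¹‖ ≤ ‖(c + N)⁻¹‖ * ‖(poch (c + 1) n)⁻¹‖ := by
    intro N
    rw [poch_succ_left, mul_inv, norm_mul]
    gcongr
    rw [norm_inv, norm_inv]
    have hc1 : 0 < (c + 1).re := by simp; linarith
    have h3 := norm_pos_iff.2 (poch_ne_zero_of_re_pos hc1 n)
    have h4 := norm_poch_le_norm_poch_add_natCast hc1 N n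
    rw [add_right_comm] at h4
    gcongr
  refine squeeze_zero_norm h2 ?_
  simpa using h1.norm.mul_const ‖(poch (c + 1) n)⁻¹‖

lemma tendsto_tsum_gaussTerm_add_natCast {a b c : ℂ} (hc : 0 < c.re) (h : 0 < (c - a - b).re) :
    Tendsto (fun N : ℕ => ∑' n, gaussTerm a b (c + N) n) atTop (𝓝 1) := by
  have h1 : ∑' n : ℕ, (if n = 0 then (1 : ℂ) else 0) = 1 := by simp
  rw [← h1]
  refine tendsto_tsum_of_dominated_convergence (summable_gaussTerm hc h).norm ?_ ?_
  · rintro (_ | n)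
    · simp [gaussTerm]
    · simpa [gaussTerm, div_eq_mul_inv] using
        ((tendsto_poch_add_natCast hc n).const_mul (poch b (n + 1))).const_mul
          (poch a (n + 1) / (n + 1).factorial)
  · refine Eventually.of_forall fun N n => ?_
    simp only [gaussTerm, norm_mul, norm_div]
    have := norm_pos_iff.2 (poch_ne_zero_of_re_pos hc n)
    have := norm_poch_le_norm_poch_add_natCast hc N n
    gcongr

/-- The recursion `c → c + 1` iterated `N` times. It is cross-multiplied and written with reciprocal
Gammas, whose functional equation holds everywhere, so poles at `c - a` or `c - b` need no separate
case. -/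
lemma tsum_gaussTerm_mul_inv_Gamma_mul (a b : ℂ) (N : ℕ) : ∀ {c : ℂ}, 0 < c.re →
    0 < (c - a - b).re →
    (∑' n, gaussTerm a b c n) * (Gamma c)⁻¹ * (Gamma (c - a - b))⁻¹ *
        ((Gamma (c + N - a))⁻¹ * (Gamma (c + N - b))⁻¹) =
      (Gamma (c - a))⁻¹ * (Gamma (c - b))⁻¹ * ((∑' n, gaussTerm a b (c + N) n) *
        (Gamma (c + N))⁻¹ * (Gamma (c + N - a - b))⁻¹) := by
  induction N with
  | zero => intro c _ _; simp; ring
  | succ N ih =>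
    intro c hc h
    have hc1 : 0 < (c + 1).re := by simp; linarith
    have h1 : 0 < (c + 1 - a - b).re := by simp at h ⊢; linarith
    have h2 := ih hc1 h1
    have h3 := tsum_gaussTerm_succ hc h
    rw [show c + ((N + 1 : ℕ) : ℂ) = c + 1 + N by push_cast; ring,
      one_div_Gamma_eq_self_mul_one_div_Gamma_add_one c,
      one_div_Gamma_eq_self_mul_one_div_Gamma_add_one (c - a),
      one_div_Gamma_eq_self_mul_one_div_Gamma_add_one (c - b),
      one_div_Gamma_eq_self_mul_one_div_Gamma_add_one (c - a - b),
      show c - a - b + 1 = c + 1 - a - b by ring, show c - a + 1 = c + 1 - a by ring,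
      show c - b + 1 = c + 1 - b by ring]
    linear_combination ((Gamma (c + 1))⁻¹ * (Gamma (c + 1 - a - b))⁻¹ *
      ((Gamma (c + 1 + N - a))⁻¹ * (Gamma (c + 1 + N - b))⁻¹)) * h3 + (c - a) * (c - b) * h2

/-- Gauss' summation theorem. -/
theorem tsum_gaussTerm {a b c : ℂ} (hc : 0 < c.re) (h : 0 < (c - a - b).re) :
    ∑' n, gaussTerm a b c n = Gamma c * Gamma (c - a - b) / (Gamma (c - a) * Gamma (c - b)) := by
  have h1 := tendsto_natCast_cpow_mul_Gamma_div_Gamma (c - a) c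
  have h2 := tendsto_natCast_cpow_mul_Gamma_div_Gamma (c - b) (c - a - b)
  have h3 := ((tendsto_tsum_gaussTerm_add_natCast hc h).mul (h1.mul h2)).const_mul
    ((Gamma (c - a))⁻¹ * (Gamma (c - b))⁻¹)
  -- Let `N → ∞` in the iterated recursion: the shifted series tends to `1`, and in the Gamma
  -- quotients the powers `N ^ a` and `N ^ (-a)` cancel.
  have h4 : Tendsto (fun _ : ℕ => (∑' n, gaussTerm a b c n) * (Gamma c)⁻¹ *
      (Gamma (c - a - b))⁻¹) atTop (𝓝 ((Gamma (c - a))⁻¹ * (Gamma (c - b))⁻¹ * (1 * (1 * 1)))) := by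
    refine h3.congr' ?_
    filter_upwards [eventually_gt_atTop 0,
      tendsto_natCast_atTop_atTop.eventually_gt_atTop (-(c - a).re),
      tendsto_natCast_atTop_atTop.eventually_gt_atTop (-(c - b).re)] with N hN hNa hNb
    have h5 := tsum_gaussTerm_mul_inv_Gamma_mul a b N hc h
    have h6 : Gamma (c + N - a) ≠ 0 := Gamma_ne_zero_of_re_pos (by simp at hNa ⊢; linarith)
    have h7 : Gamma (c + N - b) ≠ 0 := Gamma_ne_zero_of_re_pos (by simp at hNb ⊢; linarith)
    have hN0 : (N : ℂ) ≠ 0 := by exact_mod_cast hN.ne'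
    have h8 : (N : ℂ) ^ (c - (c - a)) * (N : ℂ) ^ (c - a - b - (c - b)) = 1 := by
      rw [← cpow_add _ _ hN0]; ring_nf; simp
    rw [show (N : ℂ) + (c - a) = c + N - a by ring, show (N : ℂ) + (c - b) = c + N - b by ring,
      show (N : ℂ) + (c - a - b) = c + N - a - b by ring, add_comm (N : ℂ) c]
    refine mul_right_cancel₀ (mul_ne_zero (inv_ne_zero h6) (inv_ne_zero h7)) ?_
    rw [h5]
    calc _ = ((N : ℂ) ^ (c - (c - a)) * (N : ℂ) ^ (c - a - b - (c - b))) *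
          (Gamma (c + N - a) * (Gamma (c + N - a))⁻¹) *
          (Gamma (c + N - b) * (Gamma (c + N - b))⁻¹) *
          ((Gamma (c - a))⁻¹ * (Gamma (c - b))⁻¹ * ((∑' n, gaussTerm a b (c + N) n) *
          (Gamma (c + N))⁻¹ * (Gamma (c + N - a - b))⁻¹)) := by ring
      _ = _ := by rw [h8, mul_inv_cancel₀ h6, mul_inv_cancel₀ h7]; ring
  have h5 := tendsto_nhds_unique tendsto_const_nhds h4
  have h6 := Gamma_ne_zero_of_re_pos hc
  have h7 := Gamma_ne_zero_of_re_pos h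
  rw [div_eq_mul_inv, mul_inv]
  field_simp at h5 ⊢
  linear_combination h5

/-! ### Appell's function on the half-plane `Re y < 1 / 2` -/

/-- The coefficients of the expansion of `(1 - y) ^ α' F₃(α, α', β, β'; γ; x, y)` in powers of
`x` and `y / (y - 1)`. -/
noncomputable def pfaffCoeff (α α' β β' γ : ℂ) (k : ℕ × ℕ) : ℂ :=
  poch α k.1 / k.1.factorial * (poch β k.1 / poch γ k.1) *
    (poch α' k.2 / k.2.factorial * (poch (γ + k.1 - β') k.2 / poch (γ + k.1) k.2))

lemma exists_norm_pfaffCoeff_le (α α' β β' : ℂ) {γ : ℂ} (hγ : 0 < γ.re) :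
    ∃ D : ℕ, ∀ m n : ℕ,
      ‖pfaffCoeff α α' β β' γ (m, n)‖ ≤ ((m : ℝ) + 1) ^ D * ((n : ℝ) + 1) ^ D := by
  obtain ⟨D₁, h₁⟩ := exists_norm_poch_div_factorial_le α
  obtain ⟨D₂, h₂⟩ := exists_norm_poch_div_le β hγ
  obtain ⟨D₃, h₃⟩ := exists_norm_poch_div_factorial_le α'
  -- The denominator `γ + m` varies with `m`, so the bound must be uniform in it.
  obtain ⟨D₄, h₄⟩ := exists_norm_poch_sub_div_le β' hγ
  refine ⟨D₁ + D₂ + (D₃ + D₄), fun m n => ?_⟩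
  have hγm : γ.re ≤ (γ + m).re := by simp
  have hm : (1 : ℝ) ≤ m + 1 := by simp
  have hn : (1 : ℝ) ≤ n + 1 := by simp
  calc ‖pfaffCoeff α α' β β' γ (m, n)‖
      ≤ ((m : ℝ) + 1) ^ D₁ * ((m : ℝ) + 1) ^ D₂ * (((n : ℝ) + 1) ^ D₃ * ((n : ℝ) + 1) ^ D₄) := by
        rw [pfaffCoeff, norm_mul, norm_mul, norm_mul]
        gcongr
        exacts [h₁ m, h₂ m, h₃ n, h₄ _ hγm n]
    _ ≤ _ := by
        rw [← pow_add, ← pow_add]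
        exact mul_le_mul (pow_le_pow_right₀ hm (by omega)) (pow_le_pow_right₀ hn (by omega))
          (by positivity) (by positivity)

lemma summable_bound_pow_mul_pow (D : ℕ) {r : ℝ} (h0 : 0 ≤ r) (h1 : r < 1) :
    Summable fun k : ℕ × ℕ =>
      (((k.1 : ℝ) + 1) ^ D * r ^ k.1) * (((k.2 : ℝ) + 1) ^ D * r ^ k.2) :=
  (summable_add_one_pow_mul_geometric D h0 h1).mul_of_nonneg
    (summable_add_one_pow_mul_geometric D h0 h1) (fun n => by positivity) (fun n => by positivity)

lemma norm_mul_pow_mul_pow_le {κ x v : ℂ} {m n D : ℕ} {r : ℝ}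
    (hκ : ‖κ‖ ≤ ((m : ℝ) + 1) ^ D * ((n : ℝ) + 1) ^ D) (hx : ‖x‖ ≤ r) (hv : ‖v‖ ≤ r) :
    ‖κ * (x ^ m * v ^ n)‖ ≤ (((m : ℝ) + 1) ^ D * r ^ m) * (((n : ℝ) + 1) ^ D * r ^ n) := by
  have hr : 0 ≤ r := (norm_nonneg x).trans hx
  calc ‖κ * (x ^ m * v ^ n)‖ = ‖κ‖ * (‖x‖ ^ m * ‖v‖ ^ n) := by
        rw [norm_mul, norm_mul, norm_pow, norm_pow]
    _ ≤ (((m : ℝ) + 1) ^ D * ((n : ℝ) + 1) ^ D) * (r ^ m * r ^ n) := by gcongr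
    _ = _ := by ring

/-- The double power series with the coefficients `pfaffCoeff`. -/
noncomputable def pfaffSeries (α α' β β' γ x v : ℂ) : ℂ :=
  ∑' k : ℕ × ℕ, pfaffCoeff α α' β β' γ k * (x ^ k.1 * v ^ k.2)

lemma summable_pfaffSeries (α α' β β' : ℂ) {γ x v : ℂ} (hγ : 0 < γ.re) (hx : ‖x‖ < 1)
    (hv : ‖v‖ < 1) :
    Summable fun k : ℕ × ℕ => pfaffCoeff α α' β β' γ k * (x ^ k.1 * v ^ k.2) := by
  obtain ⟨D, hD⟩ := exists_norm_pfaffCoeff_le α α' β β' hγ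
  exact Summable.of_norm_bounded
    (summable_bound_pow_mul_pow D ((norm_nonneg x).trans (le_max_left _ _)) (max_lt hx hv))
    fun k => norm_mul_pow_mul_pow_le (hD k.1 k.2) (le_max_left _ _) (le_max_right _ _)

lemma differentiableAt_pfaffSeries (α α' β β' : ℂ) {γ x v : ℂ} (hγ : 0 < γ.re) (hx : ‖x‖ < 1)
    (hv : ‖v‖ < 1) : DifferentiableAt ℂ (pfaffSeries α α' β β' γ x) v := by
  obtain ⟨D, hD⟩ := exists_norm_pfaffCoeff_le α α' β β' hγ
  obtain ⟨r, hr, hr1⟩ := exists_between (max_lt hx hv)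
  have hxr : ‖x‖ ≤ r := (le_max_left _ _).trans hr.le
  have hvr : ‖v‖ < r := (le_max_right _ _).trans_lt hr
  have h := differentiableOn_tsum_of_summable_norm (U := Metric.ball (0 : ℂ) r)
    (F := fun (k : ℕ × ℕ) v => pfaffCoeff α α' β β' γ k * (x ^ k.1 * v ^ k.2))
    (summable_bound_pow_mul_pow D ((norm_nonneg x).trans hxr) hr1) (fun k => by fun_prop)
    Metric.isOpen_ball
    fun k w hw => norm_mul_pow_mul_pow_le (hD k.1 k.2) hxr (mem_ball_zero_iff.1 hw).le
  exact h.differentiableAt (Metric.isOpen_ball.mem_nhds (mem_ball_zero_iff.2 hvr))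

/-- Since `(γ)_{m+n} = (γ)_m (γ + m)_n`, the inner sum for fixed `m` is a Gauss series with lower
parameter `γ + m`. Pfaff's transformation applies to it, with a prefactor independent of `m`. -/
lemma appellF3Series_eq (α α' β β' : ℂ) {γ x y : ℂ} (hγ : 0 < γ.re) (hx : ‖x‖ < 1)
    (hy : ‖y‖ < 1 / 3) (hv : ‖y / (y - 1)‖ < 1) :
    appellF3Series α α' β β' γ x y =
      (1 - y) ^ (-α') * pfaffSeries α α' β β' γ x (y / (y - 1)) := by
  have hre : ∀ m : ℕ, 0 < (γ + m).re := fun m => by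
    have : (0 : ℝ) ≤ m := m.cast_nonneg
    simp; linarith
  have hterm : ∀ k : ℕ × ℕ,
      poch α k.1 * poch α' k.2 * poch β k.1 * poch β' k.2 / poch γ (k.1 + k.2) *
        (x ^ k.1 / (k.1.factorial : ℂ)) * (y ^ k.2 / (k.2.factorial : ℂ)) =
      poch α k.1 / k.1.factorial * (poch β k.1 / poch γ k.1) * x ^ k.1 *
        (poch α' k.2 / k.2.factorial * (poch β' k.2 / poch (γ + k.1) k.2) * y ^ k.2) := by
    intro k
    rw [poch_add]
    have h1 := poch_ne_zero_of_re_pos hγ k.1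
    have h2 := poch_ne_zero_of_re_pos (hre k.1) k.2
    have h3 : (k.1.factorial : ℂ) ≠ 0 := by exact_mod_cast k.1.factorial_ne_zero
    have h4 : (k.2.factorial : ℂ) ≠ 0 := by exact_mod_cast k.2.factorial_ne_zero
    field_simp
  have hs : Summable fun k : ℕ × ℕ =>
      poch α k.1 / k.1.factorial * (poch β k.1 / poch γ k.1) * x ^ k.1 *
        (poch α' k.2 / k.2.factorial * (poch β' k.2 / poch (γ + k.1) k.2) * y ^ k.2) := by
    obtain ⟨D₁, h₁⟩ := exists_norm_poch_div_factorial_le α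
    obtain ⟨D₂, h₂⟩ := exists_norm_poch_div_le β hγ
    obtain ⟨D₃, h₃⟩ := exists_norm_poch_div_factorial_le α'
    obtain ⟨D₄, h₄⟩ := exists_norm_poch_div_le β' hγ
    refine summable_prod_of_norm_le
      (summable_add_one_pow_mul_geometric (D₁ + D₂) (norm_nonneg x) hx)
      (summable_add_one_pow_mul_geometric (D₃ + D₄) (norm_nonneg y) (by linarith))
      (fun n => by positivity) (fun n => by positivity) fun m n => ?_
    have h5 : ‖poch β' n / poch (γ + m) n‖ ≤ ((n : ℝ) + 1) ^ D₄ := by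
      refine le_trans ?_ (h₄ n)
      rw [norm_div, norm_div]
      have := norm_pos_iff.2 (poch_ne_zero_of_re_pos hγ n)
      have := norm_poch_le_norm_poch_add_natCast hγ m n
      gcongr
    calc _ ≤ ((m : ℝ) + 1) ^ D₁ * ((m : ℝ) + 1) ^ D₂ * ‖x‖ ^ m *
          (((n : ℝ) + 1) ^ D₃ * ((n : ℝ) + 1) ^ D₄ * ‖y‖ ^ n) := by
          simp only [norm_mul, norm_pow]
          gcongr
          exacts [h₁ m, h₂ m, h₃ n]
      _ = _ := by ring
  rw [appellF3Series, tsum_congr hterm, hs.tsum_prod, pfaffSeries,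
    (summable_pfaffSeries α α' β β' hγ hx hv).tsum_prod, ← tsum_mul_left]
  refine tsum_congr fun m => ?_
  dsimp only
  rw [tsum_mul_left, tsum_poch_mul_pow_pfaff α' β' (hre m) hy, ← mul_assoc,
    mul_comm _ ((1 - y) ^ (-α')), mul_assoc, ← tsum_mul_left]
  congr 1
  refine tsum_congr fun n => ?_
  simp only [pfaffCoeff]
  ring

/-- The half-plane consists of the points closer to `0` than to `1`. -/
lemma norm_div_sub_one_lt_one {y : ℂ} (hy : y.re < 1 / 2) : ‖y / (y - 1)‖ < 1 := by
  have h : ‖y‖ < ‖y - 1‖ := by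
    rw [norm_def, norm_def]
    refine Real.sqrt_lt_sqrt (normSq_nonneg _) ?_
    simp only [normSq_apply, sub_re, one_re, sub_im, one_im, sub_zero]
    nlinarith
  rw [norm_div, div_lt_one ((norm_nonneg y).trans_lt h)]
  exact h

/-- The right side is holomorphic on the convex half-plane `Re y < 1 / 2`, which contains `0` and
the negative axis, and agrees with the double series near `0`; hence it is the continuation along
the segment. -/
theorem appellF3_eq (α α' β β' : ℂ) {γ x y : ℂ} (hγ : 0 < γ.re) (hx : ‖x‖ < 1)
    (hy : y.re < 1 / 2) :
    appellF3 α α' β β' γ x y = (1 - y) ^ (-α') * pfaffSeries α α' β β' γ x (y / (y - 1)) := by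
  refine IsContinuationValue.segmentContinuation_eq
    ⟨{w | w.re < 1 / 2}, fun w => (1 - w) ^ (-α') * pfaffSeries α α' β β' γ x (w / (w - 1)),
      isOpen_lt continuous_re continuous_const, convex_halfSpace_re_lt _, ?_, hy, ?_, ?_, rfl⟩
  · simp
  · intro w hw
    have hw : w.re < 1 / 2 := hw
    have hw1 : w - 1 ≠ 0 := fun h => by
      rw [sub_eq_zero.1 h] at hw
      norm_num at hw
    have h1 : DifferentiableAt ℂ (fun w : ℂ => (1 - w) ^ (-α')) w := by
      refine DifferentiableAt.cpow_const (by fun_prop) (Or.inl ?_)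
      simp; linarith
    have h2 : DifferentiableAt ℂ (fun w : ℂ => w / (w - 1)) w := by
      refine DifferentiableAt.div (by fun_prop) (by fun_prop) hw1
    exact (h1.mul ((differentiableAt_pfaffSeries α α' β β' hγ hx
      (norm_div_sub_one_lt_one hw)).comp w h2)).differentiableWithinAt
  · filter_upwards [Metric.ball_mem_nhds (0 : ℂ) (show (0 : ℝ) < 1 / 3 by norm_num)] with w hw
    have hw := mem_ball_zero_iff.1 hw
    refine (appellF3Series_eq α α' β β' hγ hx hw (norm_div_sub_one_lt_one ?_)).symm
    linarith [re_le_norm w]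

/-- `(1 - u) ^ (-α') F₃(α, α', β, β'; γ; u, u / (u - 1))` as a power series in `u`. -/
noncomputable def kernelSeries (α α' β β' γ u : ℂ) : ℂ := pfaffSeries α α' β β' γ u u

lemma appellF3_kernel (α α' β β' : ℂ) {γ : ℂ} (hγ : 0 < γ.re) {z t : ℝ} (ht : t ∈ Ioo 0 z) :
    appellF3 α α' β β' γ ((1 - t / z : ℝ) : ℂ) ((1 - z / t : ℝ) : ℂ) =
      ((z / t : ℝ) : ℂ) ^ (-α') * kernelSeries α α' β β' γ ((1 - t / z : ℝ) : ℂ) := by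
  have ht0 : 0 < t := ht.1
  have hz : 0 < z := ht0.trans ht.2
  have h1 : 0 < t / z := div_pos ht0 hz
  have h2 : t / z < 1 := (div_lt_one hz).2 ht.2
  have h3 : 1 < z / t := (one_lt_div ht0).2 ht.2
  have hx : ‖((1 - t / z : ℝ) : ℂ)‖ < 1 := by
    rw [norm_real, Real.norm_of_nonneg (by linarith)]
    linarith
  rw [appellF3_eq α α' β β' hγ hx (by rw [ofReal_re]; linarith), kernelSeries]
  have h4 : ((1 - z / t : ℝ) : ℂ) / (((1 - z / t : ℝ) : ℂ) - 1) = ((1 - t / z : ℝ) : ℂ) := by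
    have h5 : (z : ℂ) ≠ 0 := ofReal_ne_zero.2 hz.ne'
    have h6 : (t : ℂ) ≠ 0 := ofReal_ne_zero.2 ht0.ne'
    push_cast
    have h7 : 1 - (z : ℂ) / t - 1 = -(z / t) := by ring
    rw [h7]
    field_simp
    ring
  rw [h4]
  congr 2
  push_cast
  ring

lemma exists_norm_kernelSeries_le (α α' β β' : ℂ) {γ : ℂ} (hγ : 0 < γ.re) {r : ℝ} (h0 : 0 ≤ r)
    (h1 : r < 1) : ∃ C : ℝ, 0 ≤ C ∧ ∀ u : ℂ, ‖u‖ ≤ r → ‖kernelSeries α α' β β' γ u‖ ≤ C := by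
  obtain ⟨D, hD⟩ := exists_norm_pfaffCoeff_le α α' β β' hγ
  have hs := summable_bound_pow_mul_pow D h0 h1
  exact ⟨∑' k : ℕ × ℕ, (((k.1 : ℝ) + 1) ^ D * r ^ k.1) * (((k.2 : ℝ) + 1) ^ D * r ^ k.2),
    tsum_nonneg fun k => by positivity, fun u hu =>
      tsum_of_norm_bounded hs.hasSum fun k => norm_mul_pow_mul_pow_le (hD k.1 k.2) hu hu⟩

lemma continuousOn_kernelSeries (α α' β β' : ℂ) {γ : ℂ} (hγ : 0 < γ.re) :
    ContinuousOn (kernelSeries α α' β β' γ) (Metric.ball 0 1) := by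
  obtain ⟨D, hD⟩ := exists_norm_pfaffCoeff_le α α' β β' hγ
  intro u hu
  obtain ⟨r, hr, hr1⟩ := exists_between (mem_ball_zero_iff.1 hu)
  have h : ContinuousOn (kernelSeries α α' β β' γ) (Metric.ball 0 r) :=
    continuousOn_tsum (fun k => by fun_prop)
      (summable_bound_pow_mul_pow D ((norm_nonneg u).trans hr.le) hr1)
      fun k w hw => norm_mul_pow_mul_pow_le (hD k.1 k.2) (mem_ball_zero_iff.1 hw).le
        (mem_ball_zero_iff.1 hw).le
  exact (h.continuousAt (Metric.isOpen_ball.mem_nhds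
    (mem_ball_zero_iff.2 hr))).continuousWithinAt

/-! ### Beta integrals over `(0, 1)` -/

/-- The Beta integrand `t ^ (u - 1) (1 - t) ^ (v - 1)`. -/
noncomputable def betaIntegrand (u v : ℂ) (t : ℝ) : ℂ := (t : ℂ) ^ (u - 1) * (1 - (t : ℂ)) ^ (v - 1)

lemma integrableOn_betaIntegrand {u v : ℂ} (hu : 0 < u.re) (hv : 0 < v.re) :
    MeasureTheory.IntegrableOn (betaIntegrand u v) (Ioo 0 1) :=
  (intervalIntegrable_iff_integrableOn_Ioo_of_le zero_le_one).1 (betaIntegral_convergent hu hv)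

lemma integral_betaIntegrand {u v : ℂ} (hu : 0 < u.re) (hv : 0 < v.re) :
    ∫ t in Ioo (0 : ℝ) 1, betaIntegrand u v t = Gamma u * Gamma v / Gamma (u + v) := by
  rw [← betaIntegral_eq_Gamma_mul_div u v hu hv, betaIntegral,
    intervalIntegral.integral_of_le zero_le_one, MeasureTheory.integral_Ioc_eq_integral_Ioo]
  rfl

lemma norm_betaIntegrand (u v : ℂ) {t : ℝ} (ht : t ∈ Ioo (0 : ℝ) 1) :
    ‖betaIntegrand u v t‖ = t ^ (u.re - 1) * (1 - t) ^ (v.re - 1) := by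
  have h : (1 - (t : ℂ)) = ((1 - t : ℝ) : ℂ) := by push_cast; rfl
  rw [betaIntegrand, norm_mul, h, norm_cpow_eq_rpow_re_of_pos ht.1,
    norm_cpow_eq_rpow_re_of_pos (sub_pos.2 ht.2)]
  simp

lemma integral_norm_betaIntegrand {u v : ℂ} (hu : 0 < u.re) (hv : 0 < v.re) :
    ∫ t in Ioo (0 : ℝ) 1, ‖betaIntegrand u v t‖ =
      ‖Gamma u.re * Gamma v.re / Gamma (u.re + v.re)‖ := by
  rw [← integral_betaIntegrand (u := (u.re : ℂ)) (v := (v.re : ℂ)) (by simpa) (by simpa)]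
  have h : ∫ t in Ioo (0 : ℝ) 1, betaIntegrand u.re v.re t =
      ((∫ t in Ioo (0 : ℝ) 1, ‖betaIntegrand u v t‖ : ℝ) : ℂ) := by
    rw [← integral_complex_ofReal]
    refine MeasureTheory.setIntegral_congr_fun measurableSet_Ioo fun t ht => ?_
    have h1 : (0 : ℝ) ≤ 1 - t := sub_nonneg.2 ht.2.le
    rw [norm_betaIntegrand u v ht, betaIntegrand]
    push_cast
    rw [ofReal_cpow ht.1.le, ofReal_cpow h1]
    push_cast
    rfl
  rw [h, norm_real, Real.norm_of_nonneg]
  exact MeasureTheory.integral_nonneg fun t => norm_nonneg _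

/-! ### The Mellin transform of the kernel -/

/-- The kernel `(1 - t) ^ (γ - 1) t ^ (-α') F₃(α, α', β, β'; γ; 1 - t, 1 - 1 / t)` on `(0, 1)`. -/
noncomputable def saigoKernel (α α' β β' γ : ℂ) (t : ℝ) : ℂ :=
  (1 - (t : ℂ)) ^ (γ - 1) * kernelSeries α α' β β' γ (1 - t)

/-- The quotient of Gamma functions by which the fractional integral multiplies `t ^ (s - 1)`. -/
noncomputable def saigoMultiplier (α α' β β' γ s : ℂ) : ℂ :=
  Gamma s * Gamma (s + γ - α - α' - β) * Gamma (s + β' - α') /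
    (Gamma (s + γ - α - α') * Gamma (s + γ - α' - β) * Gamma (s + β'))

/-- For fixed `m` the sum over `n` is a Gauss series at `1` with parameters `α'`, `γ + m - β'`; `s +
γ + m`. Its value turns the sum over `m` into a second one, with parameters `α`, `β`; `s + γ - α'`.
-/
lemma tsum_pfaffCoeff_mul_Gamma (α α' β β' : ℂ) {γ s : ℂ} (hγ : 0 < γ.re) (hs : 0 < s.re)
    (h1 : 0 < (s + β' - α').re) (h2 : 0 < (s + γ - α').re)
    (h3 : 0 < (s + γ - α - α' - β).re)
    (hsum : Summable fun k : ℕ × ℕ => pfaffCoeff α α' β β' γ k *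
      (Gamma s * Gamma (γ + (k.1 + k.2 : ℕ)) / Gamma (s + (γ + (k.1 + k.2 : ℕ))))) :
    ∑' k : ℕ × ℕ, pfaffCoeff α α' β β' γ k *
        (Gamma s * Gamma (γ + (k.1 + k.2 : ℕ)) / Gamma (s + (γ + (k.1 + k.2 : ℕ)))) =
      Gamma γ * saigoMultiplier α α' β β' γ s := by
  have hγ' := ne_neg_natCast_of_re_pos hγ
  have hsγ : 0 < (s + γ).re := by rw [add_re]; linarith
  have hinner : ∀ m : ℕ, ∑' n : ℕ, pfaffCoeff α α' β β' γ (m, n) *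
      (Gamma s * Gamma (γ + (m + n : ℕ)) / Gamma (s + (γ + (m + n : ℕ)))) =
      Gamma s * Gamma γ * Gamma (s + β' - α') / (Gamma (s + β') * Gamma (s + γ - α')) *
        gaussTerm α β (s + γ - α') m := by
    intro m
    have hm : (0 : ℝ) ≤ m := m.cast_nonneg
    have hγm : 0 < (γ + m).re := by rw [add_re, natCast_re]; linarith
    have hc : 0 < (s + γ + m).re := by rw [add_re _ (m : ℂ), natCast_re]; linarith
    have hg := tsum_gaussTerm (a := α') (b := γ + m - β') (c := s + γ + m) hc (by
      rw [show s + γ + m - α' - (γ + m - β') = s + β' - α' by ring]; exact h1)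
    rw [show s + γ + m - α' - (γ + m - β') = s + β' - α' by ring,
      show s + γ + m - (γ + m - β') = s + β' by ring,
      show s + γ + m - α' = s + γ - α' + m by ring,
      Gamma_add_natCast (ne_neg_natCast_of_re_pos h2) m] at hg
    have hterm : ∀ n : ℕ, pfaffCoeff α α' β β' γ (m, n) *
        (Gamma s * Gamma (γ + (m + n : ℕ)) / Gamma (s + (γ + (m + n : ℕ)))) =
        Gamma s * Gamma γ / Gamma (s + γ + m) * (poch α m / m.factorial * poch β m) *
          gaussTerm α' (γ + m - β') (s + γ + m) n := by
      intro n
      have e1 : s + (γ + (m + n : ℕ)) = s + γ + m + n := by push_cast; ring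
      rw [e1, Gamma_add_natCast hγ' (m + n), Gamma_add_natCast (ne_neg_natCast_of_re_pos hc) n,
        poch_add, pfaffCoeff, gaussTerm]
      have e2 := poch_ne_zero_of_re_pos hγ m
      have e3 := poch_ne_zero_of_re_pos hγm n
      have e4 := poch_ne_zero_of_re_pos hc n
      have e5 := Gamma_ne_zero_of_re_pos hc
      dsimp only
      field_simp
    rw [tsum_congr hterm, tsum_mul_left, hg, gaussTerm]
    have e5 := Gamma_ne_zero_of_re_pos hc
    have e6 := poch_ne_zero_of_re_pos h2 m
    field_simp
  rw [hsum.tsum_prod, tsum_congr hinner, tsum_mul_left, tsum_gaussTerm h2 (by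
    rw [show s + γ - α' - α - β = s + γ - α - α' - β by ring]; exact h3), saigoMultiplier,
    show s + γ - α' - α - β = s + γ - α - α' - β by ring,
    show s + γ - α' - α = s + γ - α - α' by ring]
  have e7 := Gamma_ne_zero_of_re_pos h2
  simp only [div_eq_mul_inv, mul_inv]
  field_simp

lemma cpow_mul_saigoKernel {α α' β β' γ s : ℂ} {t : ℝ} (ht : t ∈ Ioo (0 : ℝ) 1) :
    saigoKernel α α' β β' γ t * (t : ℂ) ^ (s - 1) =
      ∑' k : ℕ × ℕ, pfaffCoeff α α' β β' γ k * betaIntegrand s (γ + (k.1 + k.2 : ℕ)) t := by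
  have h0 : 1 - (t : ℂ) ≠ 0 := by
    rw [sub_ne_zero]; exact_mod_cast ht.2.ne'
  rw [saigoKernel, kernelSeries, pfaffSeries, ← tsum_mul_left, ← tsum_mul_right]
  refine tsum_congr fun k => ?_
  rw [betaIntegrand, show γ + ((k.1 + k.2 : ℕ) : ℂ) - 1 = γ - 1 + (k.1 + k.2 : ℕ) by ring,
    cpow_add _ _ h0, cpow_natCast, pow_add]
  ring

/-- The coefficients grow polynomially, while for large `Re s` the Beta integrals decay at any
prescribed polynomial rate; this justifies termwise integration. -/
lemma exists_integral_saigoKernel_mul_cpow (α α' β β' : ℂ) {γ : ℂ} (hγ : 0 < γ.re) :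
    ∃ L : ℝ, ∀ s : ℂ, L ≤ s.re →
      ∫ t in Ioo (0 : ℝ) 1, saigoKernel α α' β β' γ t * (t : ℂ) ^ (s - 1) =
        Gamma γ * saigoMultiplier α α' β β' γ s := by
  obtain ⟨D, hD⟩ := exists_norm_pfaffCoeff_le α α' β β' hγ
  -- As `(m + n + 1) ^ 2 ≥ (m + 1) * (n + 1)`, the exponent `2 * (D + 2)` absorbs the growth of
  -- degree `D` in each index and leaves inverse squares.
  obtain ⟨L, C, hL, hC, hLC⟩ := exists_norm_poch_div_le_of_le_re (γ.re : ℂ) (2 * (D + 2))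
  refine ⟨max L (max ((α' - β').re + 1) (max ((α' - γ).re + 1) ((α + α' + β - γ).re + 1))),
    fun s hs => ?_⟩
  simp only [max_le_iff] at hs
  obtain ⟨hs0, hs1, hs2, hs3⟩ := hs
  have hsre : 0 < s.re := hL.trans_le hs0
  have hγk : ∀ k : ℕ, 0 < (γ + k).re := fun k => by
    have : (0 : ℝ) ≤ k := k.cast_nonneg
    rw [add_re, natCast_re]; linarith
  have hint : ∀ k : ℕ × ℕ, MeasureTheory.Integrable
      (fun t => pfaffCoeff α α' β β' γ k * betaIntegrand s (γ + (k.1 + k.2 : ℕ)) t)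
      (MeasureTheory.volume.restrict (Ioo 0 1)) := fun k =>
    (integrableOn_betaIntegrand hsre (hγk _)).const_mul _
  have hnorm : ∀ k : ℕ × ℕ, ∫ t in Ioo (0 : ℝ) 1,
      ‖pfaffCoeff α α' β β' γ k * betaIntegrand s (γ + (k.1 + k.2 : ℕ)) t‖ =
      ‖pfaffCoeff α α' β β' γ k‖ * (‖Gamma s.re * Gamma γ.re / Gamma (s.re + γ.re)‖ *
        ‖poch γ.re (k.1 + k.2) / poch (s.re + γ.re) (k.1 + k.2)‖) := by
    intro k
    simp only [norm_mul]
    rw [MeasureTheory.integral_const_mul, integral_norm_betaIntegrand hsre (hγk _)]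
    have e1 : ((γ + ((k.1 + k.2 : ℕ) : ℂ)).re : ℂ) = γ.re + (k.1 + k.2 : ℕ) := by simp
    rw [e1, ← add_assoc, Gamma_add_natCast (ne_neg_natCast_of_re_pos (by simpa)),
      Gamma_add_natCast (ne_neg_natCast_of_re_pos (by simp; linarith)), ← norm_mul]
    rw [← norm_mul, ← norm_mul]
    congr 2
    simp only [div_eq_mul_inv, mul_inv]
    ring
  have hbound : ∀ k : ℕ × ℕ, ‖∫ t in Ioo (0 : ℝ) 1,
      ‖pfaffCoeff α α' β β' γ k * betaIntegrand s (γ + (k.1 + k.2 : ℕ)) t‖‖ ≤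
      ‖Gamma s.re * Gamma γ.re / Gamma (s.re + γ.re)‖ * C *
        ((((k.1 : ℝ) + 1) ^ 2)⁻¹ * (((k.2 : ℝ) + 1) ^ 2)⁻¹) := by
    rintro ⟨m, n⟩
    rw [hnorm, Real.norm_of_nonneg (by positivity)]
    have e1 := hD m n
    have e2 := hLC (s.re + γ.re) (by simp; linarith) (m + n)
    have e3 : ((((m + n : ℕ) : ℝ) + 1) ^ (2 * (D + 2)))⁻¹ ≤
        (((m : ℝ) + 1) ^ (D + 2) * ((n : ℝ) + 1) ^ (D + 2))⁻¹ := by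
      rw [← mul_pow, pow_mul]
      have hm : (0 : ℝ) ≤ m := m.cast_nonneg
      have hn : (0 : ℝ) ≤ n := n.cast_nonneg
      have : ((m : ℝ) + 1) * (n + 1) ≤ (((m + n : ℕ) : ℝ) + 1) ^ 2 := by
        push_cast
        nlinarith [mul_nonneg hm hn]
      gcongr
    calc _ ≤ (((m : ℝ) + 1) ^ D * ((n : ℝ) + 1) ^ D) *
          (‖Gamma s.re * Gamma γ.re / Gamma (s.re + γ.re)‖ *
          (C * (((m : ℝ) + 1) ^ (D + 2) * ((n : ℝ) + 1) ^ (D + 2))⁻¹)) := by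
          gcongr
          exact e2.trans (by gcongr)
      _ = _ := by
          dsimp only
          rw [pow_add, pow_add]
          field_simp
  have hsummable : Summable fun k : ℕ × ℕ => ∫ t in Ioo (0 : ℝ) 1,
      ‖pfaffCoeff α α' β β' γ k * betaIntegrand s (γ + (k.1 + k.2 : ℕ)) t‖ := by
    refine Summable.of_norm_bounded (Summable.mul_left _ ?_) hbound
    exact summable_add_one_inv_sq.mul_of_nonneg summable_add_one_inv_sq
      (fun n => by positivity) (fun n => by positivity)
  have h := MeasureTheory.hasSum_integral_of_summable_integral_norm hint hsummable
  have e1 : ∫ t in Ioo (0 : ℝ) 1, saigoKernel α α' β β' γ t * (t : ℂ) ^ (s - 1) =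
      ∫ t in Ioo (0 : ℝ) 1, ∑' k : ℕ × ℕ,
        pfaffCoeff α α' β β' γ k * betaIntegrand s (γ + (k.1 + k.2 : ℕ)) t :=
    MeasureTheory.setIntegral_congr_fun measurableSet_Ioo fun t ht => cpow_mul_saigoKernel ht
  have e2 : ∀ k : ℕ × ℕ, ∫ t in Ioo (0 : ℝ) 1,
      pfaffCoeff α α' β β' γ k * betaIntegrand s (γ + (k.1 + k.2 : ℕ)) t =
      pfaffCoeff α α' β β' γ k *
      (Gamma s * Gamma (γ + (k.1 + k.2 : ℕ)) / Gamma (s + (γ + (k.1 + k.2 : ℕ)))) := fun k => by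
    rw [MeasureTheory.integral_const_mul, integral_betaIntegrand hsre (hγk _)]
  rw [e1, ← h.tsum_eq, tsum_congr e2]
  rw [funext e2] at h
  simp only [add_re, sub_re] at hs1 hs2 hs3
  exact tsum_pfaffCoeff_mul_Gamma α α' β β' hγ hsre (by simp; linarith) (by simp; linarith)
    (by simp; linarith) h.summable

/-! ### Extension to the whole half-plane of absolute convergence -/

lemma norm_cpow_le_one {t : ℝ} (ht : t ∈ Ioo (0 : ℝ) 1) {w : ℂ} (hw : 0 ≤ w.re) :
    ‖(t : ℂ) ^ w‖ ≤ 1 := by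
  rw [norm_cpow_eq_rpow_re_of_pos ht.1]
  exact Real.rpow_le_one ht.1.le ht.2.le hw

lemma aestronglyMeasurable_ofReal_cpow (w : ℂ) {μ : MeasureTheory.Measure ℝ} :
    MeasureTheory.AEStronglyMeasurable (fun t : ℝ => (t : ℂ) ^ w) μ :=
  (by fun_prop : Measurable fun t : ℝ => (t : ℂ) ^ w).aestronglyMeasurable

lemma integrableOn_mul_cpow {h : ℝ → ℂ} (hh : MeasureTheory.IntegrableOn h (Ioo 0 1)) {w : ℂ}
    (hw : 0 ≤ w.re) : MeasureTheory.IntegrableOn (fun t : ℝ => h t * (t : ℂ) ^ w) (Ioo 0 1) := by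
  refine MeasureTheory.Integrable.mono hh
    (hh.aestronglyMeasurable.mul (aestronglyMeasurable_ofReal_cpow _)) ?_
  filter_upwards [MeasureTheory.ae_restrict_mem measurableSet_Ioo] with t ht
  rw [norm_mul]
  exact mul_le_of_le_one_right (norm_nonneg _) (norm_cpow_le_one ht hw)

lemma differentiableOn_integral_mul_cpow {h : ℝ → ℂ}
    (hh : MeasureTheory.IntegrableOn h (Ioo 0 1)) :
    DifferentiableOn ℂ (fun w : ℂ => ∫ t in Ioo (0 : ℝ) 1, h t * (t : ℂ) ^ w)
      {w : ℂ | 0 < w.re} := by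
  intro w hw
  have hw : 0 < w.re := hw
  -- On the ball of radius `δ = Re w / 2` about `w` the real part stays above `δ`, and `t ^ δ * |log
  -- t| ≤ 1 / δ` dominates the derivative.
  have hδ : 0 < w.re / 2 := by linarith
  refine DifferentiableAt.differentiableWithinAt ?_
  refine (hasDerivAt_integral_of_dominated_loc_of_deriv_le
    (F := fun (w : ℂ) (t : ℝ) => h t * (t : ℂ) ^ w)
    (F' := fun (w : ℂ) (t : ℝ) => h t * ((t : ℂ) ^ w * log t))
    (bound := fun t => ‖h t‖ * (1 / (w.re / 2)))
    (Metric.ball_mem_nhds w hδ) (Eventually.of_forall fun v =>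
      hh.aestronglyMeasurable.mul (aestronglyMeasurable_ofReal_cpow _))
    (integrableOn_mul_cpow hh hw.le)
    (hh.aestronglyMeasurable.mul ((aestronglyMeasurable_ofReal_cpow w).mul
      (by fun_prop : Measurable fun t : ℝ => log (t : ℂ)).aestronglyMeasurable)) ?_
    (hh.norm.mul_const _) ?_).2.differentiableAt
  · filter_upwards [MeasureTheory.ae_restrict_mem measurableSet_Ioo] with t ht v hv
    rw [norm_mul]
    gcongr
    have hv1 : w.re / 2 ≤ v.re := by
      have := (abs_re_le_norm (v - w)).trans (mem_ball_iff_norm.1 hv).le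
      rw [sub_re, abs_le] at this
      linarith [this.1]
    rw [norm_mul, norm_cpow_eq_rpow_re_of_pos ht.1, ← ofReal_log ht.1.le, norm_real,
      Real.norm_eq_abs]
    have h1 := Real.abs_log_mul_self_rpow_lt t (w.re / 2) ht.1 ht.2.le hδ
    have h2 : t ^ v.re ≤ t ^ (w.re / 2) := Real.rpow_le_rpow_of_exponent_ge ht.1 ht.2.le hv1
    rw [abs_mul, abs_of_nonneg (Real.rpow_nonneg ht.1.le _)] at h1
    calc t ^ v.re * |Real.log t| ≤ t ^ (w.re / 2) * |Real.log t| := by gcongr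
      _ ≤ _ := by rw [mul_comm]; exact h1.le
  · filter_upwards [MeasureTheory.ae_restrict_mem measurableSet_Ioo] with t ht v _
    have ht0 : (t : ℂ) ≠ 0 := ofReal_ne_zero.2 ht.1.ne'
    have := (hasStrictDerivAt_const_cpow (x := (t : ℂ)) (y := v) (Or.inl ht0)).hasDerivAt
    exact this.const_mul (h t)

lemma tendsto_integral_mul_cpow_zero {h : ℝ → ℂ}
    (hh : MeasureTheory.IntegrableOn h (Ioo 0 1)) :
    Tendsto (fun ε : ℝ => ∫ t in Ioo (0 : ℝ) 1, h t * (t : ℂ) ^ (ε : ℂ)) (𝓝[>] 0)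
      (𝓝 (∫ t in Ioo (0 : ℝ) 1, h t)) := by
  refine MeasureTheory.tendsto_integral_filter_of_dominated_convergence (fun t => ‖h t‖)
    (Eventually.of_forall fun ε => hh.aestronglyMeasurable.mul (aestronglyMeasurable_ofReal_cpow _))
    ?_ hh.norm ?_
  · filter_upwards [self_mem_nhdsWithin] with ε hε
    filter_upwards [MeasureTheory.ae_restrict_mem measurableSet_Ioo] with t ht
    rw [norm_mul]
    exact mul_le_of_le_one_right (norm_nonneg _)
      (norm_cpow_le_one ht (by rw [ofReal_re]; exact le_of_lt hε))
  · filter_upwards [MeasureTheory.ae_restrict_mem measurableSet_Ioo] with t ht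
    have ht0 : (t : ℂ) ≠ 0 := ofReal_ne_zero.2 ht.1.ne'
    have h1 : Continuous fun ε : ℝ => h t * (t : ℂ) ^ (ε : ℂ) :=
      continuous_const.mul (continuous_ofReal.const_cpow (Or.inl ht0))
    simpa using (h1.tendsto 0).mono_left nhdsWithin_le_nhds

/-- An extra factor `t ^ w` makes the integral holomorphic for `Re w > 0`. Cleared of Gamma poles,
the formula equates holomorphic functions there and is known for large `Re w`. Letting `w → 0+`
reaches `s`, even on the boundary of the region of convergence; the pole hypotheses serve only to
divide at `w = 0`. -/
theorem integral_saigoKernel_mul_cpow (α α' β β' : ℂ) {γ s : ℂ} (hγ : 0 < γ.re)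
    (hint : MeasureTheory.IntegrableOn
      (fun t : ℝ => saigoKernel α α' β β' γ t * (t : ℂ) ^ (s - 1)) (Ioo 0 1))
    (h1 : ∀ m : ℕ, s ≠ -m) (h2 : ∀ m : ℕ, s + γ - α - α' - β ≠ -m)
    (h3 : ∀ m : ℕ, s + β' - α' ≠ -m) :
    ∫ t in Ioo (0 : ℝ) 1, saigoKernel α α' β β' γ t * (t : ℂ) ^ (s - 1) =
      Gamma γ * saigoMultiplier α α' β β' γ s := by
  set Φ : ℂ → ℂ := fun w => ∫ t in Ioo (0 : ℝ) 1,
    saigoKernel α α' β β' γ t * (t : ℂ) ^ (s - 1) * (t : ℂ) ^ w with hΦ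
  set P : ℂ → ℂ := fun w => (Gamma (w + s))⁻¹ * (Gamma (w + (s + γ - α - α' - β)))⁻¹ *
    (Gamma (w + (s + β' - α')))⁻¹ with hP
  set Q : ℂ → ℂ := fun w => Gamma γ * ((Gamma (w + (s + γ - α - α')))⁻¹ *
    (Gamma (w + (s + γ - α' - β)))⁻¹ * (Gamma (w + (s + β')))⁻¹) with hQ
  have hG : ∀ a : ℂ, Differentiable ℂ fun w : ℂ => (Gamma (w + a))⁻¹ := fun a =>
    differentiable_one_div_Gamma.comp (differentiable_id.add_const a)
  have hPd : Differentiable ℂ P := ((hG _).mul (hG _)).mul (hG _)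
  have hQd : Differentiable ℂ Q := (((hG _).mul (hG _)).mul (hG _)).const_mul _
  have hU : IsOpen {w : ℂ | 0 < w.re} := isOpen_lt continuous_const continuous_re
  have hΦP : AnalyticOnNhd ℂ (fun w => Φ w * P w) {w : ℂ | 0 < w.re} :=
    ((differentiableOn_integral_mul_cpow hint).mul hPd.differentiableOn).analyticOnNhd hU
  have hQa : AnalyticOnNhd ℂ Q {w : ℂ | 0 < w.re} := hQd.differentiableOn.analyticOnNhd hU
  obtain ⟨L, hL⟩ := exists_integral_saigoKernel_mul_cpow α α' β β' hγ
  obtain ⟨R, hR0, hRL, hR1, hR2, hR3⟩ : ∃ R : ℝ, 0 < R ∧ L - s.re < R ∧ -s.re < R ∧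
      -(s + γ - α - α' - β).re < R ∧ -(s + β' - α').re < R := by
    refine ⟨max 0 (max (L - s.re) (max (-s.re) (max (-(s + γ - α - α' - β).re)
      (-(s + β' - α').re)))) + 1, ?_, ?_, ?_, ?_, ?_⟩ <;>
    simp only [← sub_lt_iff_lt_add, lt_max_iff] <;> simp
  have hlarge : ∀ w : ℂ, R < w.re → Φ w * P w = Q w := by
    intro w hw
    have e1 : Φ w = Gamma γ * saigoMultiplier α α' β β' γ (s + w) := by
      rw [← hL (s + w) (by rw [add_re]; linarith), hΦ]
      refine MeasureTheory.setIntegral_congr_fun measurableSet_Ioo fun t ht => ?_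
      have ht0 : (t : ℂ) ≠ 0 := ofReal_ne_zero.2 ht.1.ne'
      rw [mul_assoc, ← cpow_add _ _ ht0, add_sub_right_comm]
    have e2 : Gamma (w + s) ≠ 0 := Gamma_ne_zero_of_re_pos (by rw [add_re]; linarith)
    have e3 : Gamma (w + (s + γ - α - α' - β)) ≠ 0 :=
      Gamma_ne_zero_of_re_pos (by rw [add_re]; linarith)
    have e4 : Gamma (w + (s + β' - α')) ≠ 0 :=
      Gamma_ne_zero_of_re_pos (by rw [add_re]; linarith)
    rw [e1, saigoMultiplier, hP, hQ]
    rw [show s + w + γ - α - α' - β = w + (s + γ - α - α' - β) by ring,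
      show s + w + β' - α' = w + (s + β' - α') by ring,
      show s + w + γ - α - α' = w + (s + γ - α - α') by ring,
      show s + w + γ - α' - β = w + (s + γ - α' - β) by ring,
      show s + w + β' = w + (s + β') by ring, add_comm s w, div_eq_mul_inv, mul_inv, mul_inv]
    field_simp
  have hEq : EqOn (fun w => Φ w * P w) Q {w : ℂ | 0 < w.re} := by
    refine hΦP.eqOn_of_preconnected_of_eventuallyEq hQa
      (convex_halfSpace_re_gt 0).isPreconnected (z₀ := ((R + 1 : ℝ) : ℂ)) ?_ ?_
    · rw [mem_ofPred_eq, ofReal_re]; linarith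
    · filter_upwards [(isOpen_lt continuous_const continuous_re).mem_nhds
        (show ((R + 1 : ℝ) : ℂ) ∈ {w : ℂ | R < w.re} by simp)] with w hw
      exact hlarge w hw
  have hofReal : Tendsto (fun ε : ℝ => (ε : ℂ)) (𝓝[>] 0) (𝓝 0) := by
    simpa using (continuous_ofReal.tendsto 0).mono_left nhdsWithin_le_nhds
  have hlim1 := (tendsto_integral_mul_cpow_zero hint).mul ((hPd.continuous.tendsto 0).comp hofReal)
  have hlim2 := (hQd.continuous.tendsto 0).comp hofReal
  have hlim3 := hlim1.congr' (f₂ := Q ∘ fun ε : ℝ => (ε : ℂ)) (by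
    filter_upwards [self_mem_nhdsWithin] with ε hε
    exact hEq (show 0 < (ε : ℂ).re by rw [ofReal_re]; exact hε))
  have h := tendsto_nhds_unique hlim3 hlim2
  have e2 := Gamma_ne_zero h1
  have e3 := Gamma_ne_zero h2
  have e4 := Gamma_ne_zero h3
  simp only [hP, hQ, zero_add] at h
  rw [saigoMultiplier, div_eq_mul_inv, mul_inv, mul_inv]
  field_simp at h ⊢
  linear_combination h

/-! ### Termwise integration against the kernel -/

lemma one_sub_ofReal_eq (t : ℝ) : 1 - (t : ℂ) = ((1 - t : ℝ) : ℂ) := by push_cast; rfl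

lemma norm_one_sub_ofReal {t : ℝ} (ht : t ≤ 1) : ‖1 - (t : ℂ)‖ = 1 - t := by
  rw [one_sub_ofReal_eq, norm_real, Real.norm_of_nonneg (sub_nonneg.2 ht)]

lemma continuousOn_saigoKernel (α α' β β' : ℂ) {γ : ℂ} (hγ : 0 < γ.re) :
    ContinuousOn (saigoKernel α α' β β' γ) (Ioo 0 1) := by
  refine ContinuousOn.mul (fun t ht => ?_)
    ((continuousOn_kernelSeries α α' β β' hγ).comp (by fun_prop) fun t ht => ?_)
  · refine (ContinuousAt.cpow (by fun_prop) continuousAt_const ?_).continuousWithinAt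
    rw [one_sub_ofReal_eq]
    exact ofReal_mem_slitPlane.2 (sub_pos.2 ht.2)
  · rw [mem_ball_zero_iff, norm_one_sub_ofReal ht.2.le]
    linarith [ht.1]

lemma aestronglyMeasurable_saigoKernel_mul_cpow (α α' β β' : ℂ) {γ : ℂ} (hγ : 0 < γ.re) (w : ℂ)
    {S : Set ℝ} (hS : S ⊆ Ioo 0 1) :
    MeasureTheory.AEStronglyMeasurable (fun t : ℝ => saigoKernel α α' β β' γ t * (t : ℂ) ^ w)
      (MeasureTheory.volume.restrict S) :=
  (((continuousOn_saigoKernel α α' β β' hγ).aestronglyMeasurable measurableSet_Ioo).mono_measure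
    (MeasureTheory.Measure.restrict_mono hS le_rfl)).mul (aestronglyMeasurable_ofReal_cpow w)

lemma exists_norm_saigoKernel_le (α α' β β' : ℂ) {γ : ℂ} (hγ : 0 < γ.re) {δ : ℝ} (hδ : 0 < δ)
    (hδ1 : δ < 1) :
    ∃ C : ℝ, 0 ≤ C ∧ ∀ t ∈ Ico δ 1,
      ‖saigoKernel α α' β β' γ t‖ ≤ C * (1 - t) ^ (γ.re - 1) := by
  obtain ⟨C, hC, h⟩ := exists_norm_kernelSeries_le α α' β β' hγ (r := 1 - δ) (by linarith)
    (by linarith)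
  refine ⟨C, hC, fun t ht => ?_⟩
  have h1 : 0 < 1 - t := sub_pos.2 ht.2
  have h2 := h (1 - t) (by rw [norm_one_sub_ofReal ht.2.le]; linarith [ht.1])
  rw [saigoKernel, norm_mul, one_sub_ofReal_eq, norm_cpow_eq_rpow_re_of_pos h1, mul_comm,
    ← one_sub_ofReal_eq]
  simp only [sub_re, one_re]
  gcongr

lemma rpow_le_rpow_neg_abs {δ t : ℝ} (hδ : 0 < δ) (ht : δ ≤ t) (ht1 : t ≤ 1) (a : ℝ) :
    t ^ a ≤ δ ^ (-|a|) :=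
  (Real.rpow_le_rpow_of_exponent_ge (hδ.trans_le ht) ht1 (neg_abs_le a)).trans
    (Real.rpow_le_rpow_of_nonpos hδ ht (neg_nonpos.2 (abs_nonneg a)))

lemma exists_norm_saigoKernel_mul_cpow_le (α α' β β' : ℂ) {γ : ℂ} (hγ : 0 < γ.re) (w : ℂ) {δ : ℝ}
    (hδ : 0 < δ) (hδ1 : δ < 1) :
    ∃ C : ℝ, 0 ≤ C ∧ ∀ t ∈ Ico δ 1,
      ‖saigoKernel α α' β β' γ t * (t : ℂ) ^ w‖ ≤ C * (1 - t) ^ (γ.re - 1) := by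
  obtain ⟨C, hC, h⟩ := exists_norm_saigoKernel_le α α' β β' hγ hδ hδ1
  refine ⟨C * δ ^ (-|w.re|), by positivity, fun t ht => ?_⟩
  have h1 : 0 < 1 - t := sub_pos.2 ht.2
  have h2 : 0 < t := hδ.trans_le ht.1
  rw [norm_mul, norm_cpow_eq_rpow_re_of_pos h2, mul_right_comm]
  gcongr
  exacts [h t ht, rpow_le_rpow_neg_abs hδ ht.1 ht.2.le _]

lemma integrableOn_one_sub_rpow {g : ℝ} (hg : 0 < g) :
    MeasureTheory.IntegrableOn (fun t : ℝ => (1 - t) ^ (g - 1)) (Ioo 0 1) := by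
  refine (integrableOn_betaIntegrand (u := 1) (v := g) (by simp) (by simpa)).norm.congr ?_
  filter_upwards [MeasureTheory.ae_restrict_mem measurableSet_Ioo] with t ht
  rw [norm_betaIntegrand _ _ ht]
  simp

lemma integrableOn_saigoKernel_mul_cpow_Ico (α α' β β' : ℂ) {γ : ℂ} (hγ : 0 < γ.re) (w : ℂ)
    {δ : ℝ} (hδ : 0 < δ) (hδ1 : δ < 1) :
    MeasureTheory.IntegrableOn (fun t : ℝ => saigoKernel α α' β β' γ t * (t : ℂ) ^ w)
      (Ico δ 1) := by
  obtain ⟨C, -, h⟩ := exists_norm_saigoKernel_mul_cpow_le α α' β β' hγ w hδ hδ1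
  have hsub : Ico δ 1 ⊆ Ioo 0 1 := fun t ht => ⟨hδ.trans_le ht.1, ht.2⟩
  refine MeasureTheory.Integrable.mono'
    (((integrableOn_one_sub_rpow hγ).mono_set hsub).const_mul C)
    (aestronglyMeasurable_saigoKernel_mul_cpow α α' β β' hγ w hsub) ?_
  filter_upwards [MeasureTheory.ae_restrict_mem measurableSet_Ico] with t ht
  exact h t ht

/-- Divided by `r ^ N` the series is continuous at `0` with value `d N`, so near `0` it exceeds half
of it in norm. -/
lemma exists_le_norm_tsum_mul_pow {d : ℕ → ℂ} {N : ℕ} (hN : d N ≠ 0) (hlt : ∀ n < N, d n = 0)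
    (hd : Summable fun n => d n * (1 / 2 : ℂ) ^ n) :
    ∃ ρ : ℝ, 0 < ρ ∧ ∀ r : ℝ, 0 < r → r < ρ →
      ‖d N‖ / 2 * r ^ N ≤ ‖∑' n, d n * (r : ℂ) ^ n‖ := by
  have hd' : Summable fun n => ‖d (n + N)‖ * (1 / 2 : ℝ) ^ n := by
    have h := ((summable_nat_add_iff N).2 hd.norm).mul_left ((1 / 2 : ℝ) ^ N)⁻¹
    refine h.congr fun n => ?_
    rw [norm_mul, norm_pow, pow_add]
    norm_num
    field_simp
  have hcont : ContinuousOn (fun w : ℂ => ∑' n, d (n + N) * w ^ n) (Metric.ball 0 (1 / 2)) :=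
    continuousOn_tsum (fun n => by fun_prop) hd' fun n w hw => by
      rw [norm_mul, norm_pow]
      have := (mem_ball_zero_iff.1 hw).le
      gcongr
  have hat := hcont.continuousAt (Metric.ball_mem_nhds (0 : ℂ) (by norm_num))
  have h0 : ∑' n, d (n + N) * (0 : ℂ) ^ n = d N := by
    rw [tsum_eq_single 0 fun n hn => by simp [hn]]
    simp
  have hev : ∀ᶠ w in 𝓝 (0 : ℂ), ‖d N‖ / 2 < ‖∑' n, d (n + N) * w ^ n‖ := by
    have h1 := hat.norm.tendsto
    rw [h0] at h1
    exact h1.eventually_const_lt (half_lt_self (norm_pos_iff.2 hN))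
  obtain ⟨ε, hε, hball⟩ := Metric.eventually_nhds_iff_ball.1 hev
  refine ⟨min ε (1 / 2), by positivity, fun r hr hrε => ?_⟩
  have hrn : ‖(r : ℂ)‖ = r := by rw [norm_real, Real.norm_of_nonneg hr.le]
  have h2 := hball (r : ℂ) (mem_ball_zero_iff.2 (by rw [hrn]; exact hrε.trans_le (min_le_left _ _)))
  have hs : Summable fun n => d n * (r : ℂ) ^ n := by
    refine Summable.of_norm_bounded hd.norm fun n => ?_
    rw [norm_mul, norm_mul, norm_pow, norm_pow, hrn]
    have : r ≤ ‖(1 / 2 : ℂ)‖ := by norm_num; linarith [hrε.trans_le (min_le_right _ _)]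
    gcongr
  have h3 : ∑' n, d n * (r : ℂ) ^ n = (r : ℂ) ^ N * ∑' n, d (n + N) * (r : ℂ) ^ n := by
    rw [← hs.sum_add_tsum_nat_add N, Finset.sum_eq_zero fun n hn => by
      rw [hlt n (Finset.mem_range.1 hn), zero_mul], zero_add, ← tsum_mul_left]
    refine tsum_congr fun n => ?_
    rw [pow_add]
    ring
  rw [h3, norm_mul, norm_pow, hrn, mul_comm]
  gcongr

lemma cpow_mul_rpow_pow {t : ℝ} (ht : 0 < t) (σ : ℂ) (μ : ℝ) (n : ℕ) :
    (t : ℂ) ^ (σ - 1) * ((t ^ μ : ℝ) : ℂ) ^ n = (t : ℂ) ^ (σ + μ * n - 1) := by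
  have ht0 : (t : ℂ) ≠ 0 := ofReal_ne_zero.2 ht.ne'
  rw [add_sub_right_comm, cpow_add _ _ ht0, cpow_mul_nat, ofReal_cpow ht.le]

/-- Near `0` the lowest term is dominated by the whole sum; on `[δ, 1)` the kernel times any power
is integrable because `Re γ > 0`. -/
lemma integrableOn_saigoKernel_mul_cpow_of_tsum (α α' β β' σ : ℂ) {γ : ℂ} (hγ : 0 < γ.re)
    {μ : ℝ} (hμ : 0 < μ) {d : ℕ → ℂ} {N : ℕ} (hN : d N ≠ 0) (hlt : ∀ n < N, d n = 0)
    (hd : Summable fun n => d n * (1 / 2 : ℂ) ^ n)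
    (hint : MeasureTheory.IntegrableOn (fun t : ℝ => saigoKernel α α' β β' γ t *
      ((t : ℂ) ^ (σ - 1) * ∑' n, d n * ((t ^ μ : ℝ) : ℂ) ^ n)) (Ioo 0 1)) :
    MeasureTheory.IntegrableOn (fun t : ℝ => saigoKernel α α' β β' γ t *
      (t : ℂ) ^ (σ + μ * N - 1)) (Ioo 0 1) := by
  obtain ⟨ρ, hρ, hle⟩ := exists_le_norm_tsum_mul_pow hN hlt hd
  set δ : ℝ := min (ρ ^ μ⁻¹) (1 / 2) with hδdef
  have hδ : 0 < δ := lt_min (Real.rpow_pos_of_pos hρ _) (by norm_num)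
  have hδ1 : δ < 1 := (min_le_right _ _).trans_lt (by norm_num)
  have hsub : Ioo 0 δ ⊆ Ioo (0 : ℝ) 1 := Ioo_subset_Ioo_right hδ1.le
  have hunion : Ioo (0 : ℝ) 1 = Ioo 0 δ ∪ Ico δ 1 := (Ioo_union_Ico_eq_Ioo hδ hδ1.le).symm
  rw [hunion]
  refine MeasureTheory.IntegrableOn.union ?_
    (integrableOn_saigoKernel_mul_cpow_Ico α α' β β' hγ _ hδ hδ1)
  refine MeasureTheory.Integrable.mono' ((hint.mono_set hsub).norm.const_mul (2 / ‖d N‖))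
    (aestronglyMeasurable_saigoKernel_mul_cpow α α' β β' hγ _ hsub) ?_
  filter_upwards [MeasureTheory.ae_restrict_mem measurableSet_Ioo] with t ht
  have ht0 : 0 < t := ht.1
  have hr : 0 < t ^ μ := Real.rpow_pos_of_pos ht0 _
  have hrρ : t ^ μ < ρ := by
    have h1 : t < ρ ^ μ⁻¹ := ht.2.trans_le (min_le_left _ _)
    have h2 := Real.rpow_lt_rpow ht0.le h1 hμ
    rwa [Real.rpow_inv_rpow hρ.le hμ.ne'] at h2
  have h1 := hle _ hr hrρ
  have hdN := norm_pos_iff.2 hN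
  rw [← cpow_mul_rpow_pow ht0, norm_mul, norm_mul, norm_mul, norm_mul, norm_pow, norm_real,
    Real.norm_of_nonneg hr.le]
  calc _ = 2 / ‖d N‖ * (‖saigoKernel α α' β β' γ t‖ * (‖(t : ℂ) ^ (σ - 1)‖ *
        (‖d N‖ / 2 * (t ^ μ) ^ N))) := by field_simp
    _ ≤ _ := by gcongr

/-- The three exponents in the multiplier add up to `γ`, so both sides decay like `x ^ (-Re γ)`. The
constant is `2 = (3 / 2) / (3 / 4)`. -/
lemma eventually_norm_Gamma_div_Gamma_le (α α' β β' γ σ : ℂ) :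
    ∀ᶠ x : ℝ in atTop, ‖Gamma (x + 1) / Gamma (x + 1 + γ.re)‖ ≤
      2 * ‖saigoMultiplier α α' β β' γ (σ + x)‖ := by
  have h1 := (tendsto_cpow_mul_Gamma_div_Gamma 1 (1 + γ.re)).norm
  have h2 := (((tendsto_cpow_mul_Gamma_div_Gamma σ (σ + γ - α - α')).mul
    (tendsto_cpow_mul_Gamma_div_Gamma (σ + γ - α - α' - β) (σ + γ - α' - β))).mul
    (tendsto_cpow_mul_Gamma_div_Gamma (σ + β' - α') (σ + β'))).norm
  rw [mul_one, mul_one, norm_one] at h2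
  rw [norm_one] at h1
  filter_upwards [eventually_gt_atTop 0, h1.eventually_lt_const (show (1 : ℝ) < 3 / 2 by norm_num),
    h2.eventually_const_lt (show (3 / 4 : ℝ) < 1 by norm_num)] with x hx hx1 hx2
  have hx0 : (x : ℂ) ≠ 0 := ofReal_ne_zero.2 hx.ne'
  have h3 : (x : ℂ) ^ (σ + γ - α - α' - σ) * (Gamma (x + σ) / Gamma (x + (σ + γ - α - α'))) *
      ((x : ℂ) ^ (σ + γ - α' - β - (σ + γ - α - α' - β)) *
        (Gamma (x + (σ + γ - α - α' - β)) / Gamma (x + (σ + γ - α' - β)))) *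
      ((x : ℂ) ^ (σ + β' - (σ + β' - α')) *
        (Gamma (x + (σ + β' - α')) / Gamma (x + (σ + β')))) =
      (x : ℂ) ^ γ * saigoMultiplier α α' β β' γ (σ + x) := by
    have e1 : (x : ℂ) ^ γ = (x : ℂ) ^ (σ + γ - α - α' - σ) *
        (x : ℂ) ^ (σ + γ - α' - β - (σ + γ - α - α' - β)) *
        (x : ℂ) ^ (σ + β' - (σ + β' - α')) := by
      rw [← cpow_add _ _ hx0, ← cpow_add _ _ hx0]
      ring_nf
    rw [e1, saigoMultiplier,
      show σ + x + γ - α - α' - β = x + (σ + γ - α - α' - β) by ring,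
      show σ + x + β' - α' = x + (σ + β' - α') by ring,
      show σ + x + γ - α - α' = x + (σ + γ - α - α') by ring,
      show σ + x + γ - α' - β = x + (σ + γ - α' - β) by ring,
      show σ + x + β' = x + (σ + β') by ring, add_comm σ]
    simp only [div_eq_mul_inv, mul_inv]
    ring_nf
  rw [h3, norm_mul, norm_cpow_eq_rpow_re_of_pos hx] at hx2
  rw [norm_mul, norm_cpow_eq_rpow_re_of_pos hx, ← add_assoc] at hx1
  simp only [ofReal_re, add_sub_cancel_left] at hx1
  have hpos : 0 < x ^ γ.re := Real.rpow_pos_of_pos hx _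
  refine le_of_mul_le_mul_left ?_ hpos
  linarith

/-- The first summand serves `t < 1 / 2`, where `t ^ (μ (n - N))` is geometrically small; the second
serves `t ≥ 1 / 2`, where only the singularity `(1 - t) ^ (γ - 1)` matters. -/
lemma norm_saigoKernel_mul_cpow_le {α α' β β' γ σ : ℂ} {μ C : ℝ} (hμ : 0 < μ)
    (hC : ∀ t ∈ Ico (1 / 2 : ℝ) 1,
      ‖saigoKernel α α' β β' γ t * (t : ℂ) ^ (σ - 1)‖ ≤ C * (1 - t) ^ (γ.re - 1))
    {N n : ℕ} (hn : N ≤ n) {t : ℝ} (ht : t ∈ Ioo (0 : ℝ) 1) :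
    ‖saigoKernel α α' β β' γ t * (t : ℂ) ^ (σ + μ * n - 1)‖ ≤
      ((1 / 2 : ℝ) ^ μ) ^ (n - N) * ‖saigoKernel α α' β β' γ t * (t : ℂ) ^ (σ + μ * N - 1)‖ +
        C * ‖betaIntegrand (μ * n + 1) γ t‖ := by
  have ht0 : 0 < t := ht.1
  have hpow : ∀ k : ℕ, ‖((t ^ μ : ℝ) : ℂ) ^ k‖ = (t ^ μ) ^ k := fun k => by
    rw [norm_pow, norm_real, Real.norm_of_nonneg (Real.rpow_nonneg ht0.le _)]
  have hb : ‖betaIntegrand (μ * n + 1) γ t‖ = (t ^ μ) ^ n * (1 - t) ^ (γ.re - 1) := by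
    rw [norm_betaIntegrand _ _ ht, ← Real.rpow_mul_natCast ht0.le]
    simp
  rw [hb, ← cpow_mul_rpow_pow ht0, ← cpow_mul_rpow_pow ht0, ← mul_assoc, ← mul_assoc, norm_mul,
    norm_mul _ (((t ^ μ : ℝ) : ℂ) ^ N), hpow, hpow]
  have h1 : 0 < 1 - t := sub_pos.2 ht.2
  rcases lt_or_ge t (1 / 2) with h | h
  · have hC0 : 0 ≤ C := by
      have := (norm_nonneg _).trans (hC (1 / 2) ⟨le_rfl, by norm_num⟩)
      exact nonneg_of_mul_nonneg_left this (by positivity)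
    refine le_add_of_le_of_nonneg ?_ (by positivity)
    obtain ⟨k, rfl⟩ := Nat.exists_eq_add_of_le hn
    rw [Nat.add_sub_cancel_left, pow_add]
    have h2 : (t ^ μ) ^ k ≤ ((1 / 2 : ℝ) ^ μ) ^ k := by gcongr
    calc _ = (t ^ μ) ^ k * (‖saigoKernel α α' β β' γ t * (t : ℂ) ^ (σ - 1)‖ * (t ^ μ) ^ N) := by
          ring
      _ ≤ _ := by gcongr
  · refine le_add_of_nonneg_of_le (by positivity) ?_
    calc _ ≤ C * (1 - t) ^ (γ.re - 1) * (t ^ μ) ^ n := by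
          gcongr
          exact hC t ⟨h, ht.2⟩
      _ = _ := by ring

theorem integral_saigoKernel_mul_tsum (α α' β β' σ : ℂ) {γ : ℂ} (hγ : 0 < γ.re)
    {μ : ℝ} (hμ : 0 < μ) {d : ℕ → ℂ}
    (hd : ∀ r ∈ Ioo (0 : ℝ) 1, Summable fun n => d n * (r : ℂ) ^ n)
    (hint : MeasureTheory.IntegrableOn (fun t : ℝ => saigoKernel α α' β β' γ t *
      ((t : ℂ) ^ (σ - 1) * ∑' n, d n * ((t ^ μ : ℝ) : ℂ) ^ n)) (Ioo 0 1))
    (h1 : ∀ n m : ℕ, σ + μ * n ≠ -m)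
    (h2 : ∀ n m : ℕ, σ + γ - α - α' - β + μ * n ≠ -m)
    (h3 : ∀ n m : ℕ, σ + β' - α' + μ * n ≠ -m)
    (hM : Summable fun n : ℕ => d n * saigoMultiplier α α' β β' γ (σ + μ * n)) :
    ∫ t in Ioo (0 : ℝ) 1, saigoKernel α α' β β' γ t *
      ((t : ℂ) ^ (σ - 1) * ∑' n, d n * ((t ^ μ : ℝ) : ℂ) ^ n) =
      Gamma γ * ∑' n, d n * saigoMultiplier α α' β β' γ (σ + μ * n) := by
  by_cases hzero : ∀ n, d n = 0
  · simp [hzero]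
  push Not at hzero
  classical
  -- Powers below index `N` need not be integrable against the kernel, but their coefficients
  -- vanish.
  set N := Nat.find hzero with hNdef
  have hN : d N ≠ 0 := Nat.find_spec hzero
  have hlt : ∀ n < N, d n = 0 := fun n hn => not_not.1 (Nat.find_min hzero hn)
  have hhalf : Summable fun n => d n * (1 / 2 : ℂ) ^ n := by
    simpa using hd (1 / 2) ⟨by norm_num, by norm_num⟩
  have hintN := integrableOn_saigoKernel_mul_cpow_of_tsum α α' β β' σ hγ hμ hN hlt hhalf hint
  obtain ⟨C, hC0, hC⟩ := exists_norm_saigoKernel_mul_cpow_le α α' β β' hγ (σ - 1)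
    (δ := 1 / 2) (by norm_num) (by norm_num)
  have hbound := fun (n : ℕ) (hn : N ≤ n) (t : ℝ) (ht : t ∈ Ioo (0 : ℝ) 1) =>
    norm_saigoKernel_mul_cpow_le (σ := σ) hμ hC hn ht
  have hbeta : ∀ n : ℕ, 0 < ((μ : ℂ) * n + 1).re := fun n => by
    have : 0 ≤ μ * n := by positivity
    simp; linarith
  have hintbound : ∀ n : ℕ, MeasureTheory.Integrable (fun t : ℝ => ((1 / 2 : ℝ) ^ μ) ^ (n - N) *
      ‖saigoKernel α α' β β' γ t * (t : ℂ) ^ (σ + μ * N - 1)‖ +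
        C * ‖betaIntegrand (μ * n + 1) γ t‖) (MeasureTheory.volume.restrict (Ioo 0 1)) := fun n =>
    (hintN.norm.const_mul _).add ((integrableOn_betaIntegrand (hbeta n) hγ).norm.const_mul _)
  have hintn : ∀ n : ℕ, N ≤ n → MeasureTheory.IntegrableOn
      (fun t : ℝ => saigoKernel α α' β β' γ t * (t : ℂ) ^ (σ + μ * n - 1)) (Ioo 0 1) := by
    intro n hn
    refine MeasureTheory.Integrable.mono' (hintbound n)
      (aestronglyMeasurable_saigoKernel_mul_cpow α α' β β' hγ _ subset_rfl) ?_
    filter_upwards [MeasureTheory.ae_restrict_mem measurableSet_Ioo] with t ht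
    exact hbound n hn t ht
  have hterm : ∀ n : ℕ, MeasureTheory.Integrable (fun t : ℝ =>
      d n * (saigoKernel α α' β β' γ t * (t : ℂ) ^ (σ + μ * n - 1)))
      (MeasureTheory.volume.restrict (Ioo 0 1)) := by
    intro n
    rcases lt_or_ge n N with hn | hn
    · simp [hlt n hn]
    · exact (hintn n hn).const_mul _
  have hval : ∀ n : ℕ, ∫ t in Ioo (0 : ℝ) 1,
      d n * (saigoKernel α α' β β' γ t * (t : ℂ) ^ (σ + μ * n - 1)) =
      Gamma γ * (d n * saigoMultiplier α α' β β' γ (σ + μ * n)) := by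
    intro n
    rcases lt_or_ge n N with hn | hn
    · simp [hlt n hn]
    · rw [MeasureTheory.integral_const_mul, integral_saigoKernel_mul_cpow α α' β β' hγ (hintn n hn)
        (h1 n) (fun m => by
          rw [show σ + μ * n + γ - α - α' - β = σ + γ - α - α' - β + μ * n by ring]
          exact h2 n m) (fun m => by
          rw [show σ + μ * n + β' - α' = σ + β' - α' + μ * n by ring]; exact h3 n m)]
      ring
  set H : ℝ := ∫ t in Ioo (0 : ℝ) 1, ‖saigoKernel α α' β β' γ t * (t : ℂ) ^ (σ + μ * N - 1)‖
    with hH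
  have hnormle : ∀ n : ℕ, ∫ t in Ioo (0 : ℝ) 1,
      ‖d n * (saigoKernel α α' β β' γ t * (t : ℂ) ^ (σ + μ * n - 1))‖ ≤
      ‖d n‖ * (((1 / 2 : ℝ) ^ μ) ^ (n - N) * H) +
      C * ‖Gamma γ.re‖ * (‖d n‖ * ‖Gamma ((μ * n : ℝ) + 1) / Gamma ((μ * n : ℝ) + 1 + γ.re)‖) := by
    intro n
    rcases lt_or_ge n N with hn | hn
    · simp [hlt n hn]
    have e1 : (((μ : ℂ) * n + 1).re : ℂ) = ((μ * n : ℝ) : ℂ) + 1 := by simp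
    have e2 := integral_norm_betaIntegrand (hbeta n) hγ
    rw [e1, mul_div_right_comm, norm_mul] at e2
    calc _ = ‖d n‖ * ∫ t in Ioo (0 : ℝ) 1,
          ‖saigoKernel α α' β β' γ t * (t : ℂ) ^ (σ + μ * n - 1)‖ := by
          rw [← MeasureTheory.integral_const_mul]
          simp only [norm_mul]
      _ ≤ ‖d n‖ * ∫ t in Ioo (0 : ℝ) 1, (((1 / 2 : ℝ) ^ μ) ^ (n - N) *
          ‖saigoKernel α α' β β' γ t * (t : ℂ) ^ (σ + μ * N - 1)‖ +
          C * ‖betaIntegrand (μ * n + 1) γ t‖) := by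
          exact mul_le_mul_of_nonneg_left (MeasureTheory.setIntegral_mono_on (hintn n hn).norm
            (hintbound n) measurableSet_Ioo (hbound n hn)) (norm_nonneg _)
      _ = _ := by
          rw [MeasureTheory.integral_add (hintN.norm.const_mul _)
            ((integrableOn_betaIntegrand (hbeta n) hγ).norm.const_mul _),
            MeasureTheory.integral_const_mul, MeasureTheory.integral_const_mul, e2]
          ring
  have hs1 : Summable fun n : ℕ => ‖d n‖ * (((1 / 2 : ℝ) ^ μ) ^ (n - N) * H) := by
    have hr0 : 0 < (1 / 2 : ℝ) ^ μ := by positivity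
    have hr1 : (1 / 2 : ℝ) ^ μ < 1 := Real.rpow_lt_one (by norm_num) (by norm_num) hμ
    -- The part near `0` is controlled by convergence of the original series at `2 ^ (-μ)`.
    have h := (hd _ ⟨hr0, hr1⟩).norm.mul_left (((1 / 2 : ℝ) ^ μ) ^ N)⁻¹
    refine (h.mul_right H).congr fun n => ?_
    rcases lt_or_ge n N with hn | hn
    · simp [hlt n hn]
    · obtain ⟨k, rfl⟩ := Nat.exists_eq_add_of_le hn
      rw [norm_mul, norm_pow, norm_real, Real.norm_of_nonneg hr0.le, Nat.add_sub_cancel_left,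
        pow_add]
      field_simp
  have hs2 : Summable fun n : ℕ =>
      ‖d n‖ * ‖Gamma ((μ * n : ℝ) + 1) / Gamma ((μ * n : ℝ) + 1 + γ.re)‖ := by
    -- The part near `1` is controlled by the target series, through the comparison of decay rates.
    refine summable_of_isBigO_nat hM.norm (Asymptotics.IsBigO.of_bound 2 ?_)
    have hlim : Tendsto (fun n : ℕ => μ * n) atTop atTop :=
      tendsto_natCast_atTop_atTop.const_mul_atTop hμ
    filter_upwards [hlim.eventually (eventually_norm_Gamma_div_Gamma_le α α' β β' γ σ)] with n hn
    rw [Real.norm_of_nonneg (by positivity), norm_norm, norm_mul]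
    have e1 : σ + ((μ * n : ℝ) : ℂ) = σ + μ * n := by push_cast; rfl
    rw [e1] at hn
    calc _ ≤ ‖d n‖ * (2 * ‖saigoMultiplier α α' β β' γ (σ + μ * n)‖) := by gcongr
      _ = _ := by ring
  have hsum : Summable fun n : ℕ => ∫ t in Ioo (0 : ℝ) 1,
      ‖d n * (saigoKernel α α' β β' γ t * (t : ℂ) ^ (σ + μ * n - 1))‖ :=
    Summable.of_nonneg_of_le (fun n => MeasureTheory.integral_nonneg fun t => norm_nonneg _)
      hnormle (hs1.add (hs2.mul_left _))
  have h := MeasureTheory.hasSum_integral_of_summable_integral_norm hterm hsum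
  rw [← tsum_mul_left, ← tsum_congr hval, h.tsum_eq]
  refine MeasureTheory.setIntegral_congr_fun measurableSet_Ioo fun t ht => ?_
  rw [← mul_assoc, ← tsum_mul_left]
  refine tsum_congr fun n => ?_
  rw [← cpow_mul_rpow_pow ht.1]
  ring

/-! ### Scaling to the interval `(0, z)` -/

lemma integrableOn_Ioo_comp_mul_left {f : ℝ → ℂ} {z : ℝ} (hz : 0 < z)
    (hf : MeasureTheory.IntegrableOn f (Ioo 0 z)) :
    MeasureTheory.IntegrableOn (fun s => f (z * s)) (Ioo 0 1) := by
  rw [← intervalIntegrable_iff_integrableOn_Ioo_of_le hz.le] at hf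
  rw [← intervalIntegrable_iff_integrableOn_Ioo_of_le zero_le_one]
  simpa [hz.ne'] using hf.comp_mul_left (c := z)

lemma integral_Ioo_eq_mul_integral_comp_mul_left (f : ℝ → ℂ) {z : ℝ} (hz : 0 < z) :
    ∫ t in Ioo 0 z, f t = z * ∫ s in Ioo (0 : ℝ) 1, f (z * s) := by
  have h := intervalIntegral.integral_comp_mul_left (a := 0) (b := 1) f hz.ne'
  rw [mul_zero, mul_one, intervalIntegral.integral_of_le zero_le_one,
    intervalIntegral.integral_of_le hz.le, MeasureTheory.integral_Ioc_eq_integral_Ioo,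
    MeasureTheory.integral_Ioc_eq_integral_Ioo] at h
  have hz0 : (z : ℂ) ≠ 0 := ofReal_ne_zero.2 hz.ne'
  rw [h, real_smul, ofReal_inv, mul_inv_cancel_left₀ hz0]

lemma saigoMaedaIntegrand_mul (α α' β β' : ℂ) {γ : ℂ} (hγ : 0 < γ.re) (f : ℝ → ℂ) {z s : ℝ}
    (hz : 0 < z) (hs : s ∈ Ioo (0 : ℝ) 1) :
    saigoMaedaIntegrand α α' β β' γ f z (z * s) =
      (z : ℂ) ^ (γ - 1) * (z : ℂ) ^ (-α') * (saigoKernel α α' β β' γ s * f (z * s)) := by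
  have hs0 : 0 < s := hs.1
  have hmem : z * s ∈ Ioo 0 z := ⟨by positivity, mul_lt_of_lt_one_right hz hs.2⟩
  have h1 : (0 : ℝ) ≤ 1 - s := sub_nonneg.2 hs.2.le
  have e1 : ((z - z * s : ℝ) : ℂ) = (z : ℂ) * ((1 - s : ℝ) : ℂ) := by push_cast; ring
  have e2 : ((z * s : ℝ) : ℂ) ^ (-α') * ((z / (z * s) : ℝ) : ℂ) ^ (-α') = (z : ℂ) ^ (-α') := by
    rw [← mul_cpow_ofReal_nonneg hmem.1.le (div_nonneg hz.le hmem.1.le), ← ofReal_mul,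
      mul_div_cancel₀ _ hmem.1.ne']
  have e3 : 1 - z * s / z = 1 - s := by field_simp
  have h := appellF3_kernel α α' β β' hγ hmem
  rw [saigoMaedaIntegrand, h, e1, mul_cpow_ofReal_nonneg hz.le h1, ← e2, e3, saigoKernel,
    one_sub_ofReal_eq]
  ring

theorem saigoMaeda_cpow_mul_tsum (α α' β β' σ : ℂ) {γ : ℂ} (hγ : 0 < γ.re) {μ z : ℝ} (hμ : 0 < μ)
    (hz : 0 < z) (c : ℝ) (e : ℕ → ℂ)
    (hs : ∀ t ∈ Ioo 0 z, Summable fun n => e n * ((c * t ^ μ : ℝ) : ℂ) ^ n)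
    (hint : SaigoMaedaExists α α' β β' γ
      (fun t => (t : ℂ) ^ (σ - 1) * ∑' n, e n * ((c * t ^ μ : ℝ) : ℂ) ^ n) z)
    (h1 : ∀ n m : ℕ, σ + μ * n ≠ -m)
    (h2 : ∀ n m : ℕ, σ + γ - α - α' - β + μ * n ≠ -m)
    (h3 : ∀ n m : ℕ, σ + β' - α' + μ * n ≠ -m)
    (hM : Summable fun n : ℕ =>
      e n * ((c * z ^ μ : ℝ) : ℂ) ^ n * saigoMultiplier α α' β β' γ (σ + μ * n)) :
    saigoMaeda α α' β β' γ
      (fun t => (t : ℂ) ^ (σ - 1) * ∑' n, e n * ((c * t ^ μ : ℝ) : ℂ) ^ n) z =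
      (z : ℂ) ^ (σ - α - α' + γ - 1) * ∑' n : ℕ,
        e n * ((c * z ^ μ : ℝ) : ℂ) ^ n * saigoMultiplier α α' β β' γ (σ + μ * n) := by
  have hz0 : (z : ℂ) ≠ 0 := ofReal_ne_zero.2 hz.ne'
  set d : ℕ → ℂ := fun n => e n * ((c * z ^ μ : ℝ) : ℂ) ^ n with hd
  have hterm : ∀ s : ℝ, 0 < s → ∀ n, e n * ((c * (z * s) ^ μ : ℝ) : ℂ) ^ n =
      d n * ((s ^ μ : ℝ) : ℂ) ^ n := by
    intro s hs0 n
    rw [Real.mul_rpow hz.le hs0.le, ← mul_assoc, ofReal_mul, mul_pow, ← mul_assoc]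
  have hds : ∀ r ∈ Ioo (0 : ℝ) 1, Summable fun n => d n * (r : ℂ) ^ n := by
    intro r hr
    -- Every radius `r` in `(0, 1)` is attained, at `t = z * r ^ (1 / μ)`.
    have hs0 : 0 < r ^ μ⁻¹ := Real.rpow_pos_of_pos hr.1 _
    have hs1 : r ^ μ⁻¹ < 1 := Real.rpow_lt_one hr.1.le hr.2 (inv_pos.2 hμ)
    refine (hs (z * r ^ μ⁻¹) ⟨by positivity, mul_lt_of_lt_one_right hz hs1⟩).congr fun n => ?_
    rw [hterm _ hs0, Real.rpow_inv_rpow hr.1.le hμ.ne']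
  set g : ℝ → ℂ := fun s => saigoKernel α α' β β' γ s *
    ((s : ℂ) ^ (σ - 1) * ∑' n, d n * ((s ^ μ : ℝ) : ℂ) ^ n) with hg
  set K : ℂ := (z : ℂ) ^ (γ - 1) * (z : ℂ) ^ (-α') * (z : ℂ) ^ (σ - 1) with hK
  have hK0 : K ≠ 0 := by simp [hK, cpow_eq_zero_iff, hz0]
  have hscale : ∀ s ∈ Ioo (0 : ℝ) 1, saigoMaedaIntegrand α α' β β' γ
      (fun t => (t : ℂ) ^ (σ - 1) * ∑' n, e n * ((c * t ^ μ : ℝ) : ℂ) ^ n) z (z * s) =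
      K * g s := by
    intro s hs'
    rw [saigoMaedaIntegrand_mul α α' β β' hγ _ hz hs', tsum_congr (hterm s hs'.1), ofReal_mul,
      mul_cpow_ofReal_nonneg hz.le hs'.1.le]
    ring
  have hgint : MeasureTheory.IntegrableOn g (Ioo 0 1) := by
    refine ((integrableOn_Ioo_comp_mul_left hz hint).const_mul K⁻¹).congr ?_
    filter_upwards [MeasureTheory.ae_restrict_mem measurableSet_Ioo] with s hs'
    rw [hscale s hs', inv_mul_cancel_left₀ hK0]
  have hval := integral_saigoKernel_mul_tsum α α' β β' σ hγ hμ hds hgint h1 h2 h3 hM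
  rw [saigoMaeda, integral_Ioo_eq_mul_integral_comp_mul_left _ hz,
    MeasureTheory.setIntegral_congr_fun measurableSet_Ioo hscale,
    MeasureTheory.integral_const_mul, hval]
  have hG := Gamma_ne_zero_of_re_pos hγ
  -- The free factor `z` is the Jacobian of `t = z s`; the kernel and `t ^ (σ - 1)` contribute `K`.
  have hpow : (z : ℂ) ^ (σ - α - α' + γ - 1) = (z : ℂ) ^ (-α) * z * K := by
    rw [hK, ← cpow_add _ _ hz0, ← cpow_add _ _ hz0]
    nth_rewrite 3 [← cpow_one (z : ℂ)]
    rw [← cpow_add _ _ hz0, ← cpow_add _ _ hz0]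
    ring_nf
  rw [hpow]
  field_simp
  rfl

/-! ### The Fox–Wright series -/

lemma foxWrightTerm_upperParams_lowerParams {p q : ℕ} {a : Fin p → ℂ} {b : Fin q → ℂ}
    (α α' β β' γ σ η ξ κ w : ℂ) (μ : ℝ) (ha : ∀ (i : Fin p) (m : ℕ), a i ≠ -(m : ℂ))
    (hb : ∀ (j : Fin q) (m : ℕ), b j ≠ -(m : ℂ)) (hκ : ∀ m : ℕ, κ ≠ -(m : ℂ)) (n : ℕ) :
    foxWrightTerm (upperParams a α α' β β' γ σ κ μ) (lowerParams b α α' β β' γ σ η ξ μ) w n =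
      (∏ i, Gamma (a i)) / (∏ j, Gamma (b j)) * Gamma κ *
        ((∏ i, poch (a i) n) / (∏ j, poch (b j) n) *
          (poch κ n / Gamma (ξ * n + η) / n.factorial) * w ^ n *
          saigoMultiplier α α' β β' γ (σ + μ * n)) := by
  have hup : ∏ i, Gamma ((upperParams a α α' β β' γ σ κ μ i).1 +
      (upperParams a α α' β β' γ σ κ μ i).2 * n) =
      (∏ i, poch (a i) n) * (∏ i, Gamma (a i)) * (Gamma (σ + μ * n) *
        Gamma (σ + γ - α - α' - β + μ * n) * Gamma (σ + β' - α' + μ * n) *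
        (poch κ n * Gamma κ)) := by
    rw [Fin.prod_univ_add, Fin.prod_univ_four, ← Finset.prod_mul_distrib]
    simp only [upperParams, Fin.append_left, Fin.append_right, one_mul]
    congr 1
    · exact Finset.prod_congr rfl fun i _ => Gamma_add_natCast (ha i) n
    · simp [Gamma_add_natCast hκ]
  have hlow : ∏ j, Gamma ((lowerParams b α α' β β' γ σ η ξ μ j).1 +
      (lowerParams b α α' β β' γ σ η ξ μ j).2 * n) =
      (∏ j, poch (b j) n) * (∏ j, Gamma (b j)) * (Gamma (σ + γ - α - α' + μ * n) *
        Gamma (σ + γ - α' - β + μ * n) * Gamma (σ + β' + μ * n) * Gamma (η + ξ * n)) := by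
    rw [Fin.prod_univ_add, Fin.prod_univ_four, ← Finset.prod_mul_distrib]
    simp only [lowerParams, Fin.append_left, Fin.append_right, one_mul]
    congr 1
    · exact Finset.prod_congr rfl fun j _ => Gamma_add_natCast (hb j) n
  rw [foxWrightTerm, hup, hlow, saigoMultiplier,
    show σ + μ * n + γ - α - α' - β = σ + γ - α - α' - β + μ * n by ring,
    show σ + μ * n + β' - α' = σ + β' - α' + μ * n by ring,
    show σ + μ * n + γ - α - α' = σ + γ - α - α' + μ * n by ring,
    show σ + μ * n + γ - α' - β = σ + γ - α' - β + μ * n by ring,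
    show σ + μ * n + β' = σ + β' + μ * n by ring, add_comm (ξ * n) η]
  simp only [div_eq_mul_inv, mul_inv]
  ring

/-- Both series are covered at once: the `M`-series is the case `κ = 1`, where `(1)_n` cancels `n!`.
The terms enter as an abstract `T` so that either definition can be substituted. -/
theorem saigoMaeda_eq_foxWright {p q : ℕ} {a : Fin p → ℂ} {b : Fin q → ℂ}
    (α α' β β' : ℂ) {γ : ℂ} (η κ ξ σ : ℂ) {μ z : ℝ} (c : ℝ) (hκ : 0 < κ.re) (hγ : 0 < γ.re)
    (hμ : 0 < μ) (hz : 0 < z) (hb : ∀ (j : Fin q) (m : ℕ), b j ≠ -(m : ℂ))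
    (T : ℂ → ℕ → ℂ)
    (hT : ∀ w n, T w n = (∏ i, poch (a i) n) / (∏ j, poch (b j) n) *
      (poch κ n / Gamma (ξ * n + η) / n.factorial) * w ^ n)
    (hs : ∀ t ∈ Ioo (0 : ℝ) z, Summable (T ((c * t ^ μ : ℝ) : ℂ)))
    (hint : SaigoMaedaExists α α' β β' γ
      (fun t => (t : ℂ) ^ (σ - 1) * ∑' n, T ((c * t ^ μ : ℝ) : ℂ) n) z)
    (hFW : FoxWrightExists (upperParams a α α' β β' γ σ κ μ)
      (lowerParams b α α' β β' γ σ η ξ μ) ((c * z ^ μ : ℝ) : ℂ)) :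
    saigoMaeda α α' β β' γ
        (fun t => (t : ℂ) ^ (σ - 1) * ∑' n, T ((c * t ^ μ : ℝ) : ℂ) n) z =
      (∏ j, Gamma (b j)) / (∏ i, Gamma (a i)) *
        ((z : ℂ) ^ (σ - α - α' + γ - 1) / Gamma κ) *
        foxWright (upperParams a α α' β β' γ σ κ μ) (lowerParams b α α' β β' γ σ η ξ μ)
          ((c * z ^ μ : ℝ) : ℂ) := by
  obtain ⟨hpole, hsum⟩ := hFW
  -- Absence of poles at `n = 0` already makes each `Γ(aᵢ)` finite and nonzero.
  have ha : ∀ (i : Fin p) (m : ℕ), a i ≠ -(m : ℂ) := fun i m => by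
    simpa [upperParams] using hpole (Fin.castAdd 4 i) 0 m
  have h1 : ∀ n m : ℕ, σ + μ * n ≠ -m := fun n m => by
    simpa [upperParams] using hpole (Fin.natAdd p 0) n m
  have h2 : ∀ n m : ℕ, σ + γ - α - α' - β + μ * n ≠ -m := fun n m => by
    simpa [upperParams] using hpole (Fin.natAdd p 1) n m
  have h3 : ∀ n m : ℕ, σ + β' - α' + μ * n ≠ -m := fun n m => by
    simpa [upperParams] using hpole (Fin.natAdd p 2) n m
  have hterm := foxWrightTerm_upperParams_lowerParams α α' β β' γ σ η ξ κ
    ((c * z ^ μ : ℝ) : ℂ) μ ha hb (ne_neg_natCast_of_re_pos hκ)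
  have hΓa : ∏ i, Gamma (a i) ≠ 0 := Finset.prod_ne_zero_iff.2 fun i _ => Gamma_ne_zero (ha i)
  have hΓb : ∏ j, Gamma (b j) ≠ 0 := Finset.prod_ne_zero_iff.2 fun j _ => Gamma_ne_zero (hb j)
  have hΓκ := Gamma_ne_zero_of_re_pos hκ
  have hA : (∏ i, Gamma (a i)) / (∏ j, Gamma (b j)) * Gamma κ ≠ 0 :=
    mul_ne_zero (div_ne_zero hΓa hΓb) hΓκ
  have hcancel : ∀ P S : ℂ, P * S = (∏ j, Gamma (b j)) / (∏ i, Gamma (a i)) * (P / Gamma κ) *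
      ((∏ i, Gamma (a i)) / (∏ j, Gamma (b j)) * Gamma κ * S) := fun P S => by field_simp
  rw [funext hterm] at hsum
  obtain rfl : T = fun w n => (∏ i, poch (a i) n) / (∏ j, poch (b j) n) *
      (poch κ n / Gamma (ξ * n + η) / n.factorial) * w ^ n := funext fun w => funext (hT w)
  rw [saigoMaeda_cpow_mul_tsum α α' β β' σ hγ hμ hz c _ hs hint h1 h2 h3
    ((summable_mul_left_iff hA).1 hsum), foxWright, tsum_congr hterm, tsum_mul_left]
  exact hcancel _ _

theorem mainTheorem6 (p q : ℕ) (a : Fin p → ℂ) (b : Fin q → ℂ)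
    (α α' β β' γ η ν ξ σ : ℂ) (μ c z : ℝ)
    (hν : 0 < ν.re) (hξ : 0 < ξ.re) (hγ : 0 < γ.re) (hμ : 0 < μ) (hz : 0 < z)
    (hb : ∀ (j : Fin q) (m : ℕ), b j ≠ -(m : ℂ)) :
    ((∀ t ∈ Set.Ioo (0 : ℝ) z, Summable (mTerm a b ξ η ((c * t ^ μ : ℝ) : ℂ))) →
      SaigoMaedaExists α α' β β' γ
        (fun t => (t : ℂ) ^ (σ - 1) * mSeries a b ξ η ((c * t ^ μ : ℝ) : ℂ)) z →
      FoxWrightExists (upperParams a α α' β β' γ σ 1 μ) (lowerParams b α α' β β' γ σ η ξ μ)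
        ((c * z ^ μ : ℝ) : ℂ) →
      saigoMaeda α α' β β' γ
          (fun t => (t : ℂ) ^ (σ - 1) * mSeries a b ξ η ((c * t ^ μ : ℝ) : ℂ)) z =
        (∏ j, Complex.Gamma (b j)) / (∏ i, Complex.Gamma (a i)) *
          (z : ℂ) ^ (σ - α - α' + γ - 1) *
          foxWright (upperParams a α α' β β' γ σ 1 μ) (lowerParams b α α' β β' γ σ η ξ μ)
            ((c * z ^ μ : ℝ) : ℂ)) ∧
    ((∀ t ∈ Set.Ioo (0 : ℝ) z, Summable (kTerm a b ξ η ν ((c * t ^ μ : ℝ) : ℂ))) →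
      SaigoMaedaExists α α' β β' γ
        (fun t => (t : ℂ) ^ (σ - 1) * kFunction a b ξ η ν ((c * t ^ μ : ℝ) : ℂ)) z →
      FoxWrightExists (upperParams a α α' β β' γ σ ν μ) (lowerParams b α α' β β' γ σ η ξ μ)
        ((c * z ^ μ : ℝ) : ℂ) →
      saigoMaeda α α' β β' γ
          (fun t => (t : ℂ) ^ (σ - 1) * kFunction a b ξ η ν ((c * t ^ μ : ℝ) : ℂ)) z =
        (∏ j, Complex.Gamma (b j)) / (∏ i, Complex.Gamma (a i)) *
          ((z : ℂ) ^ (σ - α - α' + γ - 1) / Complex.Gamma ν) *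
          foxWright (upperParams a α α' β β' γ σ ν μ) (lowerParams b α α' β β' γ σ η ξ μ)
            ((c * z ^ μ : ℝ) : ℂ)) := by

  refine ⟨fun hs hint hFW => ?_, fun hs hint hFW => ?_⟩
  · have h := saigoMaeda_eq_foxWright α α' β β' η 1 ξ σ c (by simp) hγ hμ hz hb (mTerm a b ξ η)
      (fun w n => by
        have h1 : (n.factorial : ℂ) ≠ 0 := by exact_mod_cast n.factorial_ne_zero
        rw [mTerm, poch_one]
        field_simp) hs hint hFW
    rw [Gamma_one, div_one] at h
    exact h
  · exact saigoMaeda_eq_foxWright α α' β β' η ν ξ σ c hν hγ hμ hz hb (kTerm a b ξ η ν)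
      (fun w n => by
        rw [kTerm]
        ring) hs hint hFW
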